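/- Let $n$ and $p$ be integers with $2\le p\le n-2$, and let $(M,g)$ be a connected smooth Riemannian manifold of dimension $n$ (without boundary) with Riemann curvature tensor $R$, regarded as a symmetric $(2,2)$-double form with the sign convention that $R(u\wedge v,u\wedge v)$ is the sectional curvature of the plane spanned by orthonormal tangent vectors $u,v$. On the exterior algebra $\Lambda T_xM$ let a dot denote the Clifford product, determined by $e.\psi=e\wedge\psi-i_e\psi$ for $e\in T_xM$, and put $\mathrm{ad}_\phi(\psi)=\phi.\psi-\psi.\phi$. The Weitzenböck curvature of order $p$ at $x\in M$ is the $(p,p)$-double form $$\mathcal N_p(\psi_1,\psi_2)=\frac14\sum_{i<j,\;k<l}R(e_i\wedge e_j,e_k\wedge e_l)\,\langle \mathrm{ad}_{e_i.e_j}\psi_1,\mathrm{ad}_{e_k.e_l}\psi_2\rangle ,\qquad \psi_1,\psi_2\in\Lambda^pT_xM,$$ where $(e_1,\dots,e_n)$ is any orthonormal basis of $T_xM$. Its sectional curvature on a $p$-plane $P\subset T_xM$ is $\mathcal N_p(f_1\wedge\dots\wedge f_p,f_1\wedge\dots\wedge f_p)$, where $(f_1,\dots,f_p)$ is any orthonormal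 basis of $P$. We say that $(M,g)$ has constant Weitzenböck sectional curvature of order $p$ if at every point $x\in M$ this number is the same for all $p$-planes $P\subset T_xM$ (it may depend on $x$). Then $(M,g)$ has constant Weitzenböck sectional curvature of order $p$ if and only if either 1. $(M,g)$ has constant sectional curvature, that is, there is $\kappa\in\mathbb R$ such that every tangent $2$-plane at every point of $M$ has sectional curvature $\kappa$; or 2. $n=2p$ and $(M,g)$ is conformally flat, that is, its Weyl curvature tensor vanishes identically (note that $n\ge 4$). -/

import Mathlib

open Bundle
open scoped Manifold ContDiff

noncomputable section

namespace Weitzenboeck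

section Algebra

variable {V : Type*} [NormedAddCommGroup V] [InnerProductSpace ℝ V]

/-- The quadratic form `v ↦ -g(v, v)`; its Clifford algebra has `e.e = -g(e, e)`. -/
def negNormSq (V : Type*) [NormedAddCommGroup V] [InnerProductSpace ℝ V] : QuadraticForm ℝ V :=
  -(LinearMap.BilinMap.toQuadraticMap (innerₗ V))

/-- The Clifford product on the exterior algebra `ΛV`: the unique associative product with unit
such that `e.ψ = e ∧ ψ - i_e ψ` for every vector `e` and every `ψ ∈ ΛV`. -/
def cliffordMul (a b : ExteriorAlgebra ℝ V) : ExteriorAlgebra ℝ V :=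
  CliffordAlgebra.equivExterior (negNormSq V)
    ((CliffordAlgebra.equivExterior (negNormSq V)).symm a *
      (CliffordAlgebra.equivExterior (negNormSq V)).symm b)

/-- `ad_φ(ψ) = φ.ψ - ψ.φ`. -/
def ad (φ ψ : ExteriorAlgebra ℝ V) : ExteriorAlgebra ℝ V :=
  cliffordMul φ ψ - cliffordMul ψ φ

/-- The Clifford product `e.f` of two vectors. -/
def vecMul (e f : V) : ExteriorAlgebra ℝ V :=
  cliffordMul (ExteriorAlgebra.ι ℝ e) (ExteriorAlgebra.ι ℝ f)

/-- The component of degree `k` of an element of `ΛV`. -/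
def degreePart (k : ℕ) (a : ExteriorAlgebra ℝ V) : ⋀[ℝ]^k V :=
  DirectSum.decompose (fun i : ℕ => ⋀[ℝ]^i V) a k

variable [FiniteDimensional ℝ V]

/-- The canonical inner product on `ΛV`: the summands `Λ^k V` are pairwise orthogonal, and
`⟨x₁ ∧ ⋯ ∧ x_k, y₁ ∧ ⋯ ∧ y_k⟩ = det (g(x_i, y_j))`. -/
def extInner (a b : ExteriorAlgebra ℝ V) : ℝ :=
  ∑ k ∈ Finset.range (Module.finrank ℝ V + 1), inner ℝ (degreePart k a) (degreePart k b)

/-- The Weitzenböck transformation of order `p` of a `(2,2)`-double form `Ω`, where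
`Ω u v w z` stands for `Ω(u ∧ v, w ∧ z)`:
`N_p(Ω)(ψ₁, ψ₂) = 1/4 ∑_{i<j, k<l} Ω(e_i ∧ e_j, e_k ∧ e_l) ⟨ad_{e_i.e_j} ψ₁, ad_{e_k.e_l} ψ₂⟩`
for an orthonormal basis `(e_i)`. -/
def weitzenboeck (p : ℕ) (Ω : V → V → V → V → ℝ) (ψ₁ ψ₂ : ⋀[ℝ]^p V) : ℝ :=
  let e := stdOrthonormalBasis ℝ V
  (1 / 4) * ∑ a : Fin (Module.finrank ℝ V) × Fin (Module.finrank ℝ V) with a.1 < a.2,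
    ∑ b : Fin (Module.finrank ℝ V) × Fin (Module.finrank ℝ V) with b.1 < b.2,
      Ω (e a.1) (e a.2) (e b.1) (e b.2) *
        extInner (ad (vecMul (e a.1) (e a.2)) (ψ₁ : ExteriorAlgebra ℝ V))
          (ad (vecMul (e b.1) (e b.2)) (ψ₂ : ExteriorAlgebra ℝ V))

/-- The Ricci contraction `(cΩ)(u, w) = ∑ Ω(u ∧ e_i, w ∧ e_i)`. -/
def ricci (Ω : V → V → V → V → ℝ) (u w : V) : ℝ :=
  ∑ i, Ω u (stdOrthonormalBasis ℝ V i) w (stdOrthonormalBasis ℝ V i)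

/-- The scalar curvature `c²Ω`. -/
def scalar (Ω : V → V → V → V → ℝ) : ℝ :=
  ∑ i, ricci Ω (stdOrthonormalBasis ℝ V i) (stdOrthonormalBasis ℝ V i)

/-- The Weyl part `W = R - Ric ∧ g / (n-2) + s (g ∧ g / 2) / ((n-1)(n-2))` of a curvature form
(Kulkarni-Nomizu products), in dimension `n ≥ 3`. -/
def weyl (Ω : V → V → V → V → ℝ) (u v w z : V) : ℝ :=
  Ω u v w z
    - (ricci Ω u w * inner ℝ v z + ricci Ω v z * inner ℝ u w
        - ricci Ω u z * inner ℝ v w - ricci Ω v w * inner ℝ u z)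
      / ((Module.finrank ℝ V : ℝ) - 2)
    + scalar Ω * (inner ℝ u w * inner ℝ v z - inner ℝ u z * inner ℝ v w)
      / (((Module.finrank ℝ V : ℝ) - 1) * ((Module.finrank ℝ V : ℝ) - 2))

end Algebra

section Coordinates

variable {n : ℕ}

/-- The partial derivative `∂_i f` at `y`. -/
def partialDeriv (i : Fin n) (f : EuclideanSpace ℝ (Fin n) → ℝ) (y : EuclideanSpace ℝ (Fin n)) :
    ℝ :=
  fderiv ℝ f y (EuclideanSpace.single i 1)

/-- The Christoffel symbol `Γ^k_{ij}` of the metric with coefficient matrix `G`. -/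
def christoffel (G : EuclideanSpace ℝ (Fin n) → Matrix (Fin n) (Fin n) ℝ) (k i j : Fin n)
    (y : EuclideanSpace ℝ (Fin n)) : ℝ :=
  (1 / 2) * ∑ l, (G y)⁻¹ k l *
    (partialDeriv i (fun y' => G y' j l) y + partialDeriv j (fun y' => G y' i l) y
      - partialDeriv l (fun y' => G y' i j) y)

/-- The coefficient of `∂_m` in `R(∂_i, ∂_j) ∂_k = ∇_i ∇_j ∂_k - ∇_j ∇_i ∂_k`. -/
def riemannUp (G : EuclideanSpace ℝ (Fin n) → Matrix (Fin n) (Fin n) ℝ) (m k i j : Fin n)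
    (y : EuclideanSpace ℝ (Fin n)) : ℝ :=
  partialDeriv i (christoffel G m j k) y - partialDeriv j (christoffel G m i k) y
    + ∑ a, (christoffel G m i a y * christoffel G a j k y
        - christoffel G m j a y * christoffel G a i k y)

/-- The curvature coefficient `R(∂_i ∧ ∂_j, ∂_k ∧ ∂_l) = g(R(∂_i, ∂_j) ∂_l, ∂_k)`. -/
def riemannDown (G : EuclideanSpace ℝ (Fin n) → Matrix (Fin n) (Fin n) ℝ) (i j k l : Fin n)
    (y : EuclideanSpace ℝ (Fin n)) : ℝ :=
  ∑ m, G y k m * riemannUp G m l i j y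

end Coordinates

section Manifold

variable (n : ℕ) {M : Type*} [TopologicalSpace M] [ChartedSpace (EuclideanSpace ℝ (Fin n)) M]

instance instFiniteDimensionalTangentSpace (x : M) :
    FiniteDimensional ℝ (TangentSpace (𝓡 n) x) :=
  inferInstanceAs (FiniteDimensional ℝ (EuclideanSpace ℝ (Fin n)))

/-- The `i`-th coordinate of a tangent vector `u` at `x` in the preferred chart at `x`. -/
def tangentCoord (x : M) (u : TangentSpace (𝓡 n) x) (i : Fin n) : ℝ :=
  (show EuclideanSpace ℝ (Fin n) from
    mfderiv (𝓡 n) 𝓘(ℝ, EuclideanSpace ℝ (Fin n)) (extChartAt (𝓡 n) x) x u) i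

/-- The coordinate vector field `∂_i` of the preferred chart at `x`, at the point of coordinates
`y`. -/
def coordVec (x : M) (i : Fin n) (y : EuclideanSpace ℝ (Fin n)) :
    TangentSpace (𝓡 n) ((extChartAt (𝓡 n) x).symm y) :=
  mfderiv 𝓘(ℝ, EuclideanSpace ℝ (Fin n)) (𝓡 n) (extChartAt (𝓡 n) x).symm y
    (show EuclideanSpace ℝ (Fin n) from EuclideanSpace.single i 1)

variable [RiemannianBundle (fun x : M => TangentSpace (𝓡 n) x)]

/-- The coefficients `g(∂_i, ∂_j)` of the metric in the preferred chart at `x`. -/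
def coordMetric (x : M) (y : EuclideanSpace ℝ (Fin n)) : Matrix (Fin n) (Fin n) ℝ :=
  Matrix.of fun i j => inner ℝ (coordVec n x i y) (coordVec n x j y)

/-- The Riemann curvature tensor at `x` of the Levi-Civita connection as a `(2,2)`-double form,
`R(u ∧ v, w ∧ z) = g(R(u, v) z, w)`, so that `R(u ∧ v, u ∧ v)` is the sectional curvature of the
plane spanned by orthonormal vectors `u` and `v`. -/
def curvature (x : M) (u v w z : TangentSpace (𝓡 n) x) : ℝ :=
  ∑ i, ∑ j, ∑ k, ∑ l,
    tangentCoord n x u i * tangentCoord n x v j * tangentCoord n x w k * tangentCoord n x z l *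
      riemannDown (coordMetric n x) i j k l (extChartAt (𝓡 n) x x)

variable (M)

/-- At every point `x`, the sectional curvature `N_p(R)(e₁ ∧ ⋯ ∧ e_p, e₁ ∧ ⋯ ∧ e_p)` of the
Weitzenböck double form of order `p` is the same for all tangent `p`-planes at `x`
(`e₁, …, e_p` being an orthonormal basis of the plane). -/
def HasConstantWeitzenboeckCurvature (p : ℕ) : Prop :=
  ∀ x : M, ∃ c : ℝ, ∀ e : Fin p → TangentSpace (𝓡 n) x, Orthonormal ℝ e →
    weitzenboeck p (curvature n x) (exteriorPower.ιMulti ℝ p e) (exteriorPower.ιMulti ℝ p e) = c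

/-- All sectional curvatures, at all points, are equal to one real number. -/
def HasConstantSectionalCurvature : Prop :=
  ∃ κ : ℝ, ∀ (x : M) (e : Fin 2 → TangentSpace (𝓡 n) x), Orthonormal ℝ e →
    curvature n x (e 0) (e 1) (e 0) (e 1) = κ

/-- Conformal flatness in dimension `n ≥ 4`: the Weyl curvature tensor vanishes. -/
def IsConformallyFlat : Prop :=
  ∀ (x : M) (u v w z : TangentSpace (𝓡 n) x), weyl (curvature n x) u v w z = 0

end Manifold

end Weitzenboeck

end

/-! On orthonormal vectors the Clifford product is the wedge product. So, for an orthonormal basis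
whose first `p` vectors span `P`, the commutator with `e_s.e_t` kills `f₁ ∧ ⋯ ∧ f_p` unless exactly
one of the two vectors lies in `P`; otherwise it gives `±2` times the wedge with one factor
exchanged. These wedges are orthonormal, so the Weitzenböck sectional curvature of `P` is the sum of
`K(e_i, e_j)` over `i` inside and `j` outside `P` (`weitzenboeck_eq_sum_sectional`).

Constancy is thus a condition on the symmetric matrix `K` of each orthonormal basis: its sum over `I
× Iᶜ` is the same for all `p`-subsets `I`. Exchanging two elements of `I` independently gives `K_aj
- K_bj = K_al - K_bl`, which forces `K_aj = (r_a + r_j)/(n-2) - s/((n-1)(n-2))` with row sums `r`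
(Ricci) and total `s` (scalar curvature); by polarization the Weyl tensor vanishes. Exchanging one
element gives `(n - 2p)(K_aj - K_bj) = 0`, so for `n ≠ 2p` the Ricci values agree and the sectional
curvature is constant at each point. Conversely, constant curvature makes the sums constant
trivially, and when `n = 2p` and Weyl vanishes every Ricci value enters `p` times, leaving a
multiple of the scalar curvature.

Passing from each point to all of `M` is Schur's lemma: the second Bianchi identity makes the
curvature locally constant, and `M` is connected. Since `curvature` at `x` is computed in the
preferred chart at `x`, this also needs the invariance of the curvature operator under changes of
chart (`IsLeviCivita.curvOp_transform`). -/

noncomputable section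

namespace Weitzenboeck

/-! ### Algebraic curvature tensors and polarization. -/

section CurvatureLike

variable {V : Type*} [NormedAddCommGroup V] [InnerProductSpace ℝ V]

/-- A function of four vectors which is linear in each of them. -/
structure IsQuadrilinear (Ω : V → V → V → V → ℝ) : Prop where
  fst : ∀ v w z, IsLinearMap ℝ fun u => Ω u v w z
  snd : ∀ u w z, IsLinearMap ℝ fun v => Ω u v w z
  trd : ∀ u v z, IsLinearMap ℝ fun w => Ω u v w z
  fth : ∀ u v w, IsLinearMap ℝ fun z => Ω u v w z

/-- The algebraic symmetries of a Riemann curvature tensor. -/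
structure IsCurvatureLike (Ω : V → V → V → V → ℝ) : Prop where
  linear : ∀ v w z, IsLinearMap ℝ fun u => Ω u v w z
  swap : ∀ u v w z, Ω v u w z = -Ω u v w z
  pair : ∀ u v w z, Ω w z u v = Ω u v w z
  bianchi : ∀ u v w z, Ω u v w z + Ω v w u z + Ω w u v z = 0

/-- The curvature-like tensor of constant sectional curvature one. -/
theorem isCurvatureLike_gg :
    IsCurvatureLike fun u v w z : V => inner ℝ u w * inner ℝ v z - inner ℝ u z * inner ℝ v w where
  linear v w z := ⟨fun a b => by simp only [inner_add_left]; ring,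
    fun c a => by simp only [real_inner_smul_left, smul_eq_mul]; ring⟩
  swap u v w z := by ring
  pair u v w z := by
    simp only [real_inner_comm u w, real_inner_comm v z, real_inner_comm u z, real_inner_comm v w]
    ring
  bianchi u v w z := by
    simp only [real_inner_comm u w, real_inner_comm v w, real_inner_comm u v]
    ring

namespace IsCurvatureLike

variable {Ω : V → V → V → V → ℝ} (h : IsCurvatureLike Ω)
include h

theorem swap' (u v w z : V) : Ω u v z w = -Ω u v w z := by
  rw [← h.pair, h.swap, h.pair]

theorem self_left (u w z : V) : Ω u u w z = 0 := by
  linarith [h.swap u u w z]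

theorem self_right (u v w : V) : Ω u v w w = 0 := by
  linarith [h.swap' u v w w]

theorem isQuadrilinear : IsQuadrilinear Ω where
  fst := h.linear
  snd u w z := by
    have := (h.linear u w z)
    constructor
    · intro a b
      rw [h.swap (a + b) u, h.swap a u, h.swap b u, this.map_add]; ring
    · intro c a
      rw [h.swap (c • a) u, h.swap a u, this.map_smul]; simp
  trd u v z := by
    have := (h.linear z u v)
    simp only [h.pair] at this
    exact this
  fth u v w := by
    have := (h.linear w u v)
    simp only [h.pair] at this
    constructor
    · intro a b
      rw [h.swap' u v (a + b) w, h.swap' u v a w, h.swap' u v b w, this.map_add]; ring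
    · intro c a
      rw [h.swap' u v (c • a) w, h.swap' u v a w, this.map_smul]; simp

/-- Polarization: a curvature-like tensor is determined by its biquadratic form. -/
theorem eq_zero_of_forall_self (h0 : ∀ u v, Ω u v u v = 0) (u v w z : V) : Ω u v w z = 0 := by
  have q := h.isQuadrilinear
  have h1 : ∀ u v w, Ω u v w v = 0 := by
    intro u v w
    have e := h0 (u + w) v
    rw [(q.fst _ _ _).map_add, (q.trd _ _ _).map_add, (q.trd _ _ _).map_add, h0, h0,
      h.pair u v w v] at e
    linarith
  have h2 : ∀ u v w z, Ω u z w v = -Ω u v w z := by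
    intro u v w z
    have e := h1 u (v + z) w
    rw [(q.snd _ _ _).map_add, (q.fth _ _ _).map_add, (q.fth _ _ _).map_add, h1, h1] at e
    linarith
  have e1 := h.bianchi u v w z
  -- By `h2` and the pair of skew symmetries, Ω alternates in all four arguments. The cyclic shifts
  -- in the Bianchi identity are even, so that identity reads `3Ω = 0`.
  have e2 : Ω v w u z = Ω u v w z := by
    rw [h.swap w v u z, h2 w z u v, h.swap z w u v, h.pair u v z w, h.swap' u v w z]; ring
  have e3 : Ω w u v z = Ω u v w z := by
    rw [h2 w z v u, h.swap z w v u, h.pair v u z w, h.swap' v u w z, h.swap u v w z]; ring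
  linarith

/-- Scaling reduces orthogonal pairs to orthonormal ones, and subtracting from `v` its projection on
`u` does not change `Ω u v u v`, so Gram-Schmidt reduces everything to polarization. -/
theorem eq_zero_of_orthonormal
    (h0 : ∀ e : Fin 2 → V, Orthonormal ℝ e → Ω (e 0) (e 1) (e 0) (e 1) = 0) (u v w z : V) :
    Ω u v w z = 0 := by
  have q := h.isQuadrilinear
  have h1 : ∀ u v : V, inner ℝ u v = 0 → Ω u v u v = 0 := by
    intro u v huv
    by_cases hu : u = 0
    · subst hu; exact (q.fst _ _ _).map_zero
    by_cases hv : v = 0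
    · subst hv; exact (q.snd _ _ _).map_zero
    have ho : Orthonormal ℝ ![‖u‖⁻¹ • u, ‖v‖⁻¹ • v] := by
      rw [orthonormal_iff_ite]
      intro i j
      have hu' : ‖u‖ ≠ 0 := norm_ne_zero_iff.2 hu
      have hv' : ‖v‖ ≠ 0 := norm_ne_zero_iff.2 hv
      have huv' : inner ℝ v u = 0 := by rw [real_inner_comm, huv]
      fin_cases i <;> fin_cases j <;>
        simp [inner_smul_left, inner_smul_right, huv, huv', norm_smul, hu, hv]
    have e := h0 _ ho
    simp only [Matrix.cons_val_zero, Matrix.cons_val_one, (q.fst _ _ _).map_smul,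
      (q.snd _ _ _).map_smul, (q.trd _ _ _).map_smul, (q.fth _ _ _).map_smul, smul_eq_mul] at e
    simpa [hu, hv] using e
  refine h.eq_zero_of_forall_self (fun u v => ?_) u v w z
  by_cases hu : u = 0
  · subst hu; exact (q.fst _ _ _).map_zero
  set c := (inner ℝ u v : ℝ) / inner ℝ u u with hc
  have hv : v = (v - c • u) + c • u := by simp
  have ho : inner ℝ u (v - c • u) = 0 := by
    have : inner ℝ u u ≠ 0 := by simpa using hu
    rw [inner_sub_right, inner_smul_right, hc, div_mul_cancel₀ _ this, sub_self]
  rw [hv, (q.snd _ _ _).map_add, (q.fth _ _ _).map_add, (q.snd _ _ _).map_smul,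
    (q.fth _ _ _).map_smul, h.self_left, h1 _ _ ho, h.self_right]
  simp

/-- The difference with `κ` times the model tensor is curvature-like and vanishes on orthonormal
pairs. -/
theorem eq_of_sectional_eq {κ : ℝ}
    (h0 : ∀ e : Fin 2 → V, Orthonormal ℝ e → Ω (e 0) (e 1) (e 0) (e 1) = κ) (u v w z : V) :
    Ω u v w z = κ * (inner ℝ u w * inner ℝ v z - inner ℝ u z * inner ℝ v w) := by
  have hg := isCurvatureLike_gg (V := V)
  have hT : IsCurvatureLike fun u v w z : V =>
      Ω u v w z - κ * (inner ℝ u w * inner ℝ v z - inner ℝ u z * inner ℝ v w) := by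
    refine ⟨fun v w z => ⟨fun a b => ?_, fun c a => ?_⟩, fun u v w z => ?_, fun u v w z => ?_,
      fun u v w z => ?_⟩
    · rw [(h.linear _ _ _).map_add, (hg.linear v w z).map_add]; ring
    · rw [(h.linear _ _ _).map_smul, (hg.linear v w z).map_smul]; simp only [smul_eq_mul]; ring
    · linear_combination h.swap u v w z - κ * hg.swap u v w z
    · linear_combination h.pair u v w z - κ * hg.pair u v w z
    · linear_combination h.bianchi u v w z - κ * hg.bianchi u v w z
  refine sub_eq_zero.1 (hT.eq_zero_of_orthonormal (fun e he => ?_) u v w z)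
  have h1 := orthonormal_iff_ite.1 he
  simp [h0 e he, h1, he.1]

end IsCurvatureLike

end CurvatureLike

/-! ### Basis-independent traces: Ricci, scalar and Weyl. -/

section Trace

variable {V : Type*} [NormedAddCommGroup V] [InnerProductSpace ℝ V]
variable {ι κ : Type*} [Fintype ι] [Fintype κ]

/-- The trace of a bilinear form does not depend on the orthonormal basis. -/
theorem sum_orthonormalBasis_eq (b : OrthonormalBasis ι ℝ V) (b' : OrthonormalBasis κ ℝ V)
    {F : V → V → ℝ} (h1 : ∀ v, IsLinearMap ℝ fun u => F u v) (h2 : ∀ u, IsLinearMap ℝ (F u)) :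
    ∑ i, F (b i) (b i) = ∑ j, F (b' j) (b' j) := by
  set B : V →ₗ[ℝ] V →ₗ[ℝ] ℝ := LinearMap.mk₂ ℝ F (fun u v w => (h1 w).map_add u v)
    (fun c u w => (h1 w).map_smul c u) (fun u => (h2 u).map_add) (fun c u => (h2 u).map_smul c)
  have hB : ∀ u v, F u v = B u v := fun u v => rfl
  simp only [hB]
  have hl : ∀ x y, B x y = ∑ j, inner ℝ (b' j) x * B (b' j) y := fun x y => by
    conv_lhs => rw [← b'.sum_repr' x]
    simp
  have hr : ∀ x y, B x y = ∑ i, inner ℝ (b i) y * B x (b i) := fun x y => by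
    conv_lhs => rw [← b.sum_repr' y]
    simp
  calc ∑ i, B (b i) (b i) = ∑ i, ∑ j, inner ℝ (b' j) (b i) * B (b' j) (b i) :=
        Finset.sum_congr rfl fun i _ => hl _ _
    _ = ∑ j, B (b' j) (b' j) := by
        rw [Finset.sum_comm]
        refine Finset.sum_congr rfl fun j _ => ?_
        rw [hr (b' j) (b' j)]
        simp only [real_inner_comm]

variable [FiniteDimensional ℝ V] {Ω : V → V → V → V → ℝ}

theorem ricci_eq_sum (q : IsQuadrilinear Ω) (b : OrthonormalBasis ι ℝ V) (u w : V) :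
    ricci Ω u w = ∑ i, Ω u (b i) w (b i) :=
  sum_orthonormalBasis_eq _ b (F := fun x y => Ω u x w y) (fun _ => q.snd _ _ _)
    fun _ => q.fth _ _ _

theorem ricci_linear_left (q : IsQuadrilinear Ω) (w : V) :
    IsLinearMap ℝ fun u => ricci Ω u w := by
  constructor
  · intro a b
    simp only [ricci, (q.fst _ _ _).map_add, Finset.sum_add_distrib]
  · intro c a
    simp only [ricci, (q.fst _ _ _).map_smul, Finset.smul_sum]

theorem ricci_linear_right (q : IsQuadrilinear Ω) (u : V) :
    IsLinearMap ℝ fun w => ricci Ω u w := by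
  constructor
  · intro a b
    simp only [ricci, (q.trd _ _ _).map_add, Finset.sum_add_distrib]
  · intro c a
    simp only [ricci, (q.trd _ _ _).map_smul, Finset.smul_sum]

theorem ricci_comm (h : IsCurvatureLike Ω) (u w : V) : ricci Ω u w = ricci Ω w u :=
  Finset.sum_congr rfl fun _ _ => h.pair _ _ _ _

theorem scalar_eq_sum (q : IsQuadrilinear Ω) (b : OrthonormalBasis ι ℝ V) :
    scalar Ω = ∑ i, ricci Ω (b i) (b i) :=
  sum_orthonormalBasis_eq _ b (fun v => ricci_linear_left q v) fun u => ricci_linear_right q u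

/-- Makes polarization available for the Weyl tensor, whose vanishing then need only be tested on
orthonormal pairs. -/
theorem weyl_isCurvatureLike (h : IsCurvatureLike Ω) : IsCurvatureLike (weyl Ω) where
  linear v w z := by
    have q := h.isQuadrilinear
    constructor
    · intro a b
      simp only [weyl, (q.fst _ _ _).map_add, (ricci_linear_left q _).map_add, inner_add_left]
      ring
    · intro c a
      simp only [weyl, (q.fst _ _ _).map_smul, (ricci_linear_left q _).map_smul,
        real_inner_smul_left, smul_eq_mul]
      ring
  swap u v w z := by
    simp only [weyl, h.swap u v]
    ring
  pair u v w z := by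
    simp only [weyl, h.pair u v, real_inner_comm u w, real_inner_comm v z, real_inner_comm u z,
      real_inner_comm v w, ricci_comm h w u, ricci_comm h z v, ricci_comm h z u, ricci_comm h w v]
    ring
  bianchi u v w z := by
    simp only [weyl]
    have e := h.bianchi u v w z
    rw [real_inner_comm u w, real_inner_comm v w, real_inner_comm u v, ricci_comm h w u,
      ricci_comm h w v, ricci_comm h v u]
    linear_combination e

end Trace

/-! ### Products of anticommuting elements. -/

section AnticommutingFamily

variable {A ι : Type*} [Ring A] [Algebra ℝ A] [DecidableEq ι] {x : ι → A}

/-- Each factor passed costs a sign, which `length` counts; a factor equal to `x i` costs none, and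
`count` undoes it. -/
theorem mul_prod_of_anticommute (h : ∀ i j, i ≠ j → x i * x j = -(x j * x i)) (i : ι)
    (l : List ι) :
    x i * (l.map x).prod = (-1 : ℝ) ^ (l.length + l.count i) • ((l.map x).prod * x i) := by
  induction l with
  | nil => simp
  | cons k l ih =>
    rw [List.map_cons, List.prod_cons, List.length_cons, List.count_cons]
    by_cases hk : k = i
    · subst hk
      rw [mul_assoc, ih, mul_smul_comm]
      congr 1
      rw [if_pos (beq_self_eq_true k),
        show l.length + 1 + (l.count k + 1) = l.length + l.count k + 2 by ring, pow_add _ _ 2]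
      simp
    · rw [← mul_assoc, h i k (Ne.symm hk), neg_mul, mul_assoc, ih, mul_smul_comm, ← neg_smul,
        mul_assoc]
      congr 1
      simp only [beq_iff_eq, hk, ↓reduceIte]
      ring

theorem mul_mul_prod_of_anticommute (h : ∀ i j, i ≠ j → x i * x j = -(x j * x i)) (i j : ι)
    (l : List ι) :
    x i * x j * (l.map x).prod
      = (-1 : ℝ) ^ (l.count i + l.count j) • ((l.map x).prod * (x i * x j)) := by
  rw [mul_assoc, mul_prod_of_anticommute h j, mul_smul_comm, ← mul_assoc,
    mul_prod_of_anticommute h i, smul_mul_assoc, smul_smul, mul_assoc, ← pow_add]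
  congr 1
  rw [show l.length + l.count j + (l.length + l.count i)
    = 2 * l.length + (l.count i + l.count j) by ring, pow_add, pow_mul]
  simp

theorem mul_mul_prod_of_nodup (h : ∀ i j, i ≠ j → x i * x j = -(x j * x i)) (i j : ι)
    {l : List ι} (hl : l.Nodup) :
    x i * x j * (l.map x).prod
      = (-1 : ℝ) ^ ((if i ∈ l then 1 else 0) + (if j ∈ l then 1 else 0)) •
        ((l.map x).prod * (x i * x j)) := by
  rw [mul_mul_prod_of_anticommute h, hl.count, hl.count]

/-- The pair `x i * x j` passes without sign through the factors before `x i`, and then `x i * x j *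
x i = x j`. -/
theorem mul_mul_prod_replace (h : ∀ i j, i ≠ j → x i * x j = -(x j * x i))
    (h1 : ∀ i, x i * x i = -1) {i j : ι} {l : List ι} (hl : l.Nodup) (hi : i ∈ l) (hj : j ∉ l) :
    x i * x j * (l.map x).prod = (l.map fun k => x (if k = i then j else k)).prod := by
  obtain ⟨l₁, l₂, rfl⟩ := List.append_of_mem hi
  have hij : i ≠ j := fun hij => hj (hij ▸ hi)
  rw [List.nodup_append, List.nodup_cons] at hl
  have h1i : i ∉ l₁ := fun h' => hl.2.2 i h' i (by simp) rfl
  have h2i : i ∉ l₂ := hl.2.1.1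
  have h1j : j ∉ l₁ := fun h' => hj (by simp [h'])
  have e1 : (l₁.map fun k => x (if k = i then j else k)) = l₁.map x :=
    List.map_congr_left fun k hk => by rw [if_neg]; rintro rfl; exact h1i hk
  have e2 : (l₂.map fun k => x (if k = i then j else k)) = l₂.map x :=
    List.map_congr_left fun k hk => by rw [if_neg]; rintro rfl; exact h2i hk
  rw [List.map_append, List.map_append, List.map_cons, List.map_cons, List.prod_append,
    List.prod_append, List.prod_cons, List.prod_cons, e1, e2, if_pos rfl, ← mul_assoc,
    mul_mul_prod_of_anticommute h, List.count_eq_zero_of_not_mem h1i,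
    List.count_eq_zero_of_not_mem h1j, add_zero, pow_zero, one_smul, mul_assoc]
  congr 1
  rw [h i j hij, neg_mul, mul_assoc, ← mul_assoc (x i), h1]
  simp

end AnticommutingFamily

/-! ### Clifford commutators on wedges of orthonormal vectors. -/

section Clifford

variable {V : Type*} [NormedAddCommGroup V] [InnerProductSpace ℝ V]

theorem equivExterior_ι (v : V) :
    CliffordAlgebra.equivExterior (negNormSq V) (CliffordAlgebra.ι _ v) = ExteriorAlgebra.ι ℝ v :=
  CliffordAlgebra.changeForm_ι CliffordAlgebra.changeForm.associated_neg_proof v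

theorem equivExterior_ι_mul (v : V) (a : CliffordAlgebra (negNormSq V)) :
    CliffordAlgebra.equivExterior (negNormSq V) (CliffordAlgebra.ι _ v * a) =
      ExteriorAlgebra.ι ℝ v * CliffordAlgebra.equivExterior _ a -
        CliffordAlgebra.contractLeft (QuadraticMap.associated (-negNormSq V) v)
          (CliffordAlgebra.equivExterior (negNormSq V) a) :=
  CliffordAlgebra.changeForm_ι_mul CliffordAlgebra.changeForm.associated_neg_proof v a

theorem cliffordMul_equivExterior (a b : CliffordAlgebra (negNormSq V)) :
    cliffordMul (CliffordAlgebra.equivExterior _ a) (CliffordAlgebra.equivExterior _ b)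
      = CliffordAlgebra.equivExterior _ (a * b) := by
  simp only [cliffordMul, LinearEquiv.symm_apply_apply]

theorem vecMul_eq (u v : V) :
    vecMul u v = CliffordAlgebra.equivExterior (negNormSq V)
      (CliffordAlgebra.ι _ u * CliffordAlgebra.ι _ v) := by
  rw [vecMul, ← equivExterior_ι, ← equivExterior_ι, cliffordMul_equivExterior]

/-- Turns `ad` into a commutator in the Clifford algebra, where associativity and anticommutation
can be used. -/
theorem ad_equivExterior (a b : CliffordAlgebra (negNormSq V)) :
    ad (CliffordAlgebra.equivExterior _ a) (CliffordAlgebra.equivExterior _ b)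
      = CliffordAlgebra.equivExterior _ (a * b - b * a) := by
  rw [ad, cliffordMul_equivExterior, cliffordMul_equivExterior, map_sub]

theorem contractLeft_prod_eq_zero {d : Module.Dual ℝ V} {l : List V} (h : ∀ v ∈ l, d v = 0) :
    CliffordAlgebra.contractLeft d (l.map (ExteriorAlgebra.ι ℝ)).prod = 0 := by
  induction l with
  | nil => simp
  | cons v l ih =>
    rw [List.map_cons, List.prod_cons]
    refine (CliffordAlgebra.contractLeft_ι_mul _ _ _).trans ?_
    rw [h v (by simp), ih fun w hw => h w (by simp [hw])]
    simp

/-- In `e.ψ = e ∧ ψ - i_e ψ` the contraction vanishes when `e` is orthogonal to all factors of `ψ`.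
-/
theorem equivExterior_prod {l : List V} (h : l.Pairwise fun u v => inner ℝ u v = 0) :
    CliffordAlgebra.equivExterior (negNormSq V) (l.map (CliffordAlgebra.ι _)).prod
      = (l.map (ExteriorAlgebra.ι ℝ)).prod := by
  induction l with
  | nil => exact CliffordAlgebra.changeForm_one CliffordAlgebra.changeForm.associated_neg_proof
  | cons v l ih =>
    rw [List.pairwise_cons] at h
    rw [List.map_cons, List.prod_cons, List.map_cons, List.prod_cons]
    rw [equivExterior_ι_mul, ih h.2, contractLeft_prod_eq_zero, sub_zero]
    intro w hw
    have := h.1 w hw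
    simp [negNormSq, QuadraticMap.associated_apply, inner_add_right, this,
      real_inner_comm v w]

theorem equivExterior_prod_orthonormal {ι : Type*} {f : ι → V} (hf : Orthonormal ℝ f) {l : List ι}
    (hl : l.Nodup) :
    CliffordAlgebra.equivExterior (negNormSq V)
        (l.map fun i => CliffordAlgebra.ι (negNormSq V) (f i)).prod
      = (l.map fun i => ExteriorAlgebra.ι ℝ (f i)).prod := by
  have := equivExterior_prod (l := l.map f) (List.pairwise_map.2 (hl.imp fun h => hf.2 h))
  simpa [List.map_map, Function.comp_def] using this

theorem ι_mul_ι_swap {u v : V} (h : inner ℝ u v = 0) :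
    CliffordAlgebra.ι (negNormSq V) u * CliffordAlgebra.ι _ v
      = -(CliffordAlgebra.ι _ v * CliffordAlgebra.ι _ u) := by
  have hp : QuadraticMap.polar (negNormSq V) u v = 0 := by
    simp [negNormSq, QuadraticMap.polar, inner_add_right, h, real_inner_comm u v]
  rw [eq_neg_iff_add_eq_zero, CliffordAlgebra.ι_mul_ι_add_swap, hp, map_zero]

theorem ι_mul_ι_self {u : V} (h : ‖u‖ = 1) :
    CliffordAlgebra.ι (negNormSq V) u * CliffordAlgebra.ι _ u = -1 := by
  have hq : negNormSq V u = -1 := by simp [negNormSq, h]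
  rw [CliffordAlgebra.ι_sq_scalar, hq, map_neg, map_one]

theorem vecMul_swap {u v : V} (h : inner ℝ u v = 0) : vecMul v u = -vecMul u v := by
  rw [vecMul_eq, vecMul_eq, ι_mul_ι_swap h, map_neg, neg_neg]

theorem vecMul_linear_left (v : V) : IsLinearMap ℝ fun u : V => vecMul u v := by
  constructor <;> intros <;> simp only [vecMul_eq, map_add, add_mul, map_smul, smul_mul_assoc]

theorem vecMul_linear_right (u : V) : IsLinearMap ℝ fun v : V => vecMul u v := by
  constructor <;> intros <;> simp only [vecMul_eq, map_add, mul_add, map_smul, mul_smul_comm]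

theorem ad_linear_left (ψ : ExteriorAlgebra ℝ V) : IsLinearMap ℝ fun φ => ad φ ψ := by
  constructor <;> intros <;>
    simp only [ad, cliffordMul, map_add, mul_add, add_mul, map_smul, mul_smul_comm, smul_mul_assoc,
      smul_sub]
  abel

theorem degreePart_linear (k : ℕ) :
    IsLinearMap ℝ fun a : ExteriorAlgebra ℝ V => degreePart k a := by
  constructor
  · intro a b
    simp [degreePart, DirectSum.decompose_add]
  · intro c a
    simp only [degreePart, DirectSum.decompose_smul]
    rfl

variable [FiniteDimensional ℝ V]

theorem extInner_linear_left (b : ExteriorAlgebra ℝ V) : IsLinearMap ℝ fun a => extInner a b := by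
  constructor <;> intros <;>
    simp only [extInner, (degreePart_linear (V := V) _).map_add,
      (degreePart_linear (V := V) _).map_smul,
      inner_add_left, real_inner_smul_left, Finset.sum_add_distrib, Finset.mul_sum, smul_eq_mul]

theorem extInner_linear_right (a : ExteriorAlgebra ℝ V) : IsLinearMap ℝ (extInner a) := by
  constructor <;> intros <;>
    simp only [extInner, (degreePart_linear (V := V) _).map_add,
      (degreePart_linear (V := V) _).map_smul,
      inner_add_right, real_inner_smul_right, Finset.sum_add_distrib, Finset.mul_sum, smul_eq_mul]

theorem extInner_coe {p : ℕ} (hp : p ≤ Module.finrank ℝ V) (a b : ⋀[ℝ]^p V) :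
    extInner (a : ExteriorAlgebra ℝ V) b = inner ℝ a b := by
  rw [extInner, Finset.sum_eq_single p]
  · simp [degreePart]
  · intro k _ hk
    simp [degreePart, DirectSum.decompose_coe, DirectSum.of_eq_of_ne _ _ _ hk]
  · intro h
    exact absurd (Finset.mem_range.2 (by omega)) h

/-- Multilinearity is what permits replacing the standard basis in `weitzenboeck` by one adapted to
the plane. -/
theorem extInner_ad_isQuadrilinear (ψ : ExteriorAlgebra ℝ V) :
    IsQuadrilinear fun u v w z : V => extInner (ad (vecMul u v) ψ) (ad (vecMul w z) ψ) := by
  constructor <;> intros <;> constructor <;> intros <;>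
    simp only [(vecMul_linear_left (V := V) _).map_add, (vecMul_linear_left (V := V) _).map_smul,
      (vecMul_linear_right (V := V) _).map_add, (vecMul_linear_right (V := V) _).map_smul,
      (ad_linear_left (V := V) _).map_add, (ad_linear_left (V := V) _).map_smul,
      (extInner_linear_left (V := V) _).map_add, (extInner_linear_left (V := V) _).map_smul,
      (extInner_linear_right (V := V) _).map_add, (extInner_linear_right (V := V) _).map_smul]

section Frame

variable {p q : ℕ} (b : OrthonormalBasis (Fin p ⊕ Fin q) ℝ V)

/-- The wedge product `f₁ ∧ ⋯ ∧ f_p` with `f_i` replaced by the `j`-th complementary vector. -/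
def replacedWedge (i : Fin p) (j : Fin q) : ⋀[ℝ]^p V :=
  exteriorPower.ιMulti ℝ p fun k => b (if k = i then .inr j else .inl k)

omit [FiniteDimensional ℝ V] in
-- When both indices are inside the wedge, or both outside, the two signs agree, so `e_s.e_t`
-- commutes with the product.
theorem ad_vecMul_ιMulti {s t : Fin p ⊕ Fin q} (hst : s.isLeft = t.isLeft) :
    ad (vecMul (b s) (b t)) (exteriorPower.ιMulti ℝ p fun k => b (.inl k) : ⋀[ℝ]^p V) = 0 := by
  set l : List (Fin p ⊕ Fin q) := (List.finRange p).map .inl with hl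
  have hl' : l.Nodup := (List.nodup_finRange p).map Sum.inl_injective
  have e : ((exteriorPower.ιMulti ℝ p fun k => b (.inl k) : ⋀[ℝ]^p V) : ExteriorAlgebra ℝ V)
      = CliffordAlgebra.equivExterior (negNormSq V)
        (l.map fun i => CliffordAlgebra.ι (negNormSq V) (b i)).prod := by
    rw [equivExterior_prod_orthonormal b.orthonormal hl', exteriorPower.ιMulti_apply_coe,
      ExteriorAlgebra.ιMulti_apply, List.ofFn_eq_map, hl, List.map_map]
    rfl
  rw [e, vecMul_eq, ad_equivExterior,
    mul_mul_prod_of_nodup (fun i j hij => ι_mul_ι_swap (b.orthonormal.2 hij)) s t hl']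
  have hc : ∀ s : Fin p ⊕ Fin q, s ∈ l ↔ s.isLeft := by
    rintro (i | j) <;> simp [hl]
  simp only [hc, hst]
  rw [Even.neg_one_pow ⟨_, rfl⟩, one_smul, sub_self, map_zero]

omit [FiniteDimensional ℝ V] in
-- With exactly one index inside, `e_i.e_j` anticommutes with the product; the commutator is twice
-- `e_i.e_j` times the wedge, and that multiplication substitutes `e_j` for `e_i`.
theorem ad_vecMul_ιMulti_inl_inr (i : Fin p) (j : Fin q) :
    ad (vecMul (b (.inl i)) (b (.inr j))) (exteriorPower.ιMulti ℝ p fun k => b (.inl k) : ⋀[ℝ]^p V)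
      = (2 : ℝ) • (replacedWedge b i j : ExteriorAlgebra ℝ V) := by
  set l : List (Fin p ⊕ Fin q) := (List.finRange p).map .inl with hl
  have hl' : l.Nodup := (List.nodup_finRange p).map Sum.inl_injective
  have e : ((exteriorPower.ιMulti ℝ p fun k => b (.inl k) : ⋀[ℝ]^p V) : ExteriorAlgebra ℝ V)
      = CliffordAlgebra.equivExterior (negNormSq V)
        (l.map fun i => CliffordAlgebra.ι (negNormSq V) (b i)).prod := by
    rw [equivExterior_prod_orthonormal b.orthonormal hl', exteriorPower.ιMulti_apply_coe,
      ExteriorAlgebra.ιMulti_apply, List.ofFn_eq_map, hl, List.map_map]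
    rfl
  have hi : (.inl i : Fin p ⊕ Fin q) ∈ l := by simp [hl]
  have hj : (.inr j : Fin p ⊕ Fin q) ∉ l := by simp [hl]
  have hanti : ∀ s t : Fin p ⊕ Fin q, s ≠ t →
      CliffordAlgebra.ι (negNormSq V) (b s) * CliffordAlgebra.ι (negNormSq V) (b t)
        = -(CliffordAlgebra.ι (negNormSq V) (b t) * CliffordAlgebra.ι (negNormSq V) (b s)) :=
    fun s t hst => ι_mul_ι_swap (b.orthonormal.2 hst)
  have h1 := mul_mul_prod_of_nodup hanti (.inl i) (.inr j) hl'
  rw [if_pos hi, if_neg hj, add_zero, pow_one,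
    neg_smul, one_smul, ← neg_eq_iff_eq_neg] at h1
  have h2 := mul_mul_prod_replace hanti (fun s => ι_mul_ι_self (b.orthonormal.1 s)) hl' hi hj
  rw [e, vecMul_eq, ad_equivExterior, ← h1, sub_neg_eq_add, ← two_smul ℝ, map_smul, h2]
  congr 1
  rw [hl, List.map_map]
  have ho : Orthonormal ℝ fun k : Fin p => b (if k = i then .inr j else .inl k) := by
    refine b.orthonormal.comp _ fun k k' hk => ?_
    split_ifs at hk with h h' h'
    · rw [h, h']
    · exact Sum.inl_injective hk
  rw [replacedWedge, exteriorPower.ιMulti_apply_coe, ExteriorAlgebra.ιMulti_apply,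
    List.ofFn_eq_map, ← equivExterior_prod_orthonormal ho (List.nodup_finRange p)]
  simp only [Function.comp_def, Sum.inl.injEq]

omit [FiniteDimensional ℝ V] in
theorem ad_vecMul_ιMulti_inr_inl (i : Fin p) (j : Fin q) :
    ad (vecMul (b (.inr j)) (b (.inl i))) (exteriorPower.ιMulti ℝ p fun k => b (.inl k) : ⋀[ℝ]^p V)
      = (-2 : ℝ) • (replacedWedge b i j : ExteriorAlgebra ℝ V) := by
  have h := (ad_linear_left (V := V)
    (exteriorPower.ιMulti ℝ p fun k => b (.inl k) : ⋀[ℝ]^p V)).map_neg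
    (vecMul (b (.inl i)) (b (.inr j)))
  rw [vecMul_swap (b.orthonormal.2 Sum.inl_ne_inr), h, ad_vecMul_ιMulti_inl_inr, neg_smul]

/-- The inner product is a Gram determinant. For equal index pairs the matrix is the identity;
otherwise one wedge contains a vector orthogonal to all factors of the other, and a column vanishes.
-/
theorem inner_replacedWedge (i i' : Fin p) (j j' : Fin q) :
    inner ℝ (replacedWedge b i j) (replacedWedge b i' j') = if i = i' ∧ j = j' then 1 else 0 := by
  have hb := orthonormal_iff_ite.1 b.orthonormal
  rw [replacedWedge, replacedWedge, exteriorPower.inner_ιMulti_ιMulti]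
  split_ifs with h
  · obtain ⟨rfl, rfl⟩ := h
    convert Matrix.det_one (n := Fin p) (R := ℝ)
    ext k l
    rw [Matrix.of_apply, hb, Matrix.one_apply]
    congr 1
    split_ifs <;> simp_all [eq_comm]
  · by_cases hj : j = j'
    · have hi : i ≠ i' := fun hi => h ⟨hi, hj⟩
      refine Matrix.det_eq_zero_of_column_eq_zero i' fun k => ?_
      rw [Matrix.of_apply, hb, if_neg]
      split_ifs <;> simp_all [eq_comm]
    · refine Matrix.det_eq_zero_of_column_eq_zero i fun k => ?_
      rw [Matrix.of_apply, hb, if_neg]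
      split_ifs <;> simp_all [eq_comm]

end Frame

end Clifford

/-! ### Basis independence of the Weitzenböck form. -/

section Weitzenboeck

variable {V : Type*} [NormedAddCommGroup V] [InnerProductSpace ℝ V] [FiniteDimensional ℝ V]
variable {ι κ : Type*} [Fintype ι] [Fintype κ]

theorem sum_comm_three (f : ι → κ → κ → ℝ) :
    ∑ i, ∑ k, ∑ l, f i k l = ∑ k, ∑ l, ∑ i, f i k l := by
  rw [Finset.sum_comm]
  exact Finset.sum_congr rfl fun k _ => Finset.sum_comm

omit [FiniteDimensional ℝ V] in
-- A full contraction is an iterated trace, so the basis can be changed one slot at a time.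
theorem sum_quadrilinear_eq (b : OrthonormalBasis ι ℝ V) (b' : OrthonormalBasis κ ℝ V)
    {Ω Φ : V → V → V → V → ℝ} (hΩ : IsQuadrilinear Ω) (hΦ : IsQuadrilinear Φ) :
    ∑ i, ∑ j, ∑ k, ∑ l, Ω (b i) (b j) (b k) (b l) * Φ (b i) (b j) (b k) (b l)
      = ∑ i, ∑ j, ∑ k, ∑ l, Ω (b' i) (b' j) (b' k) (b' l) * Φ (b' i) (b' j) (b' k) (b' l) := by
  have hl : ∀ {f : V → ℝ}, IsLinearMap ℝ f → ∀ c : ℝ, IsLinearMap ℝ fun u => f u * c :=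
    fun {f} hf c => ⟨fun x y => by rw [hf.map_add, add_mul],
      fun a x => by rw [hf.map_smul, smul_mul_assoc]⟩
  have hr : ∀ {f : V → ℝ}, IsLinearMap ℝ f → ∀ c : ℝ, IsLinearMap ℝ fun u => c * f u :=
    fun {f} hf c => ⟨fun x y => by rw [hf.map_add, mul_add],
      fun a x => by rw [hf.map_smul, mul_smul_comm]⟩
  have e4 : ∀ u v w, ∑ l, Ω u v w (b l) * Φ u v w (b l) = ∑ l, Ω u v w (b' l) * Φ u v w (b' l) :=
    fun u v w => sum_orthonormalBasis_eq b b' (F := fun x y => Ω u v w x * Φ u v w y)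
      (fun _ => hl (hΩ.fth _ _ _) _) fun _ => hr (hΦ.fth _ _ _) _
  have e3 : ∀ u v z, ∑ l, Ω u v (b l) z * Φ u v (b l) z = ∑ l, Ω u v (b' l) z * Φ u v (b' l) z :=
    fun u v z => sum_orthonormalBasis_eq b b' (F := fun x y => Ω u v x z * Φ u v y z)
      (fun _ => hl (hΩ.trd _ _ _) _) fun _ => hr (hΦ.trd _ _ _) _
  have e2 : ∀ u w z, ∑ l, Ω u (b l) w z * Φ u (b l) w z = ∑ l, Ω u (b' l) w z * Φ u (b' l) w z :=
    fun u w z => sum_orthonormalBasis_eq b b' (F := fun x y => Ω u x w z * Φ u y w z)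
      (fun _ => hl (hΩ.snd _ _ _) _) fun _ => hr (hΦ.snd _ _ _) _
  have e1 : ∀ v w z, ∑ l, Ω (b l) v w z * Φ (b l) v w z = ∑ l, Ω (b' l) v w z * Φ (b' l) v w z :=
    fun v w z => sum_orthonormalBasis_eq b b' (F := fun x y => Ω x v w z * Φ y v w z)
      (fun _ => hl (hΩ.fst _ _ _) _) fun _ => hr (hΦ.fst _ _ _) _
  have two : ∀ H : V → V → ℝ, (∀ v, ∑ i, H (b i) v = ∑ i, H (b' i) v) →
      (∀ u, ∑ j, H u (b j) = ∑ j, H u (b' j)) →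
      ∑ i, ∑ j, H (b i) (b j) = ∑ i, ∑ j, H (b' i) (b' j) := fun H h1 h2 => by
    rw [Finset.sum_congr rfl fun i _ => h2 (b i), Finset.sum_comm,
      Finset.sum_congr rfl fun j _ => h1 (b' j), Finset.sum_comm]
  have e34 : ∀ u v, ∑ k, ∑ l, Ω u v (b k) (b l) * Φ u v (b k) (b l)
      = ∑ k, ∑ l, Ω u v (b' k) (b' l) * Φ u v (b' k) (b' l) := fun u v =>
    two (fun w z => Ω u v w z * Φ u v w z) (fun z => e3 u v z) fun w => e4 u v w
  rw [Finset.sum_congr rfl fun i _ => Finset.sum_congr rfl fun j _ => e34 (b i) (b j)]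
  refine two (fun u v => ∑ k, ∑ l, Ω u v (b' k) (b' l) * Φ u v (b' k) (b' l))
    (fun v => ?_) fun u => ?_
  · rw [sum_comm_three, sum_comm_three]
    exact Finset.sum_congr rfl fun k _ => Finset.sum_congr rfl fun l _ => e1 _ _ _
  · rw [sum_comm_three, sum_comm_three]
    exact Finset.sum_congr rfl fun k _ => Finset.sum_congr rfl fun l _ => e2 _ _ _

theorem sum_filter_lt {n : ℕ} {f : Fin n → Fin n → ℝ} (hs : ∀ a b, f a b = f b a)
    (h0 : ∀ a, f a a = 0) :
    ∑ a : Fin n × Fin n with a.1 < a.2, f a.1 a.2 = (1 / 2) * ∑ a, ∑ b, f a b := by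
  have h1 : ∑ a : Fin n × Fin n with a.1 < a.2, f a.1 a.2
      = ∑ a : Fin n × Fin n with a.2 < a.1, f a.1 a.2 := by
    refine Finset.sum_nbij' Prod.swap Prod.swap ?_ ?_ ?_ ?_ ?_ <;> simp
    exact fun a b _ => hs a b
  have h2 : ∑ a, ∑ b, f a b = ∑ a : Fin n × Fin n with a.1 < a.2, f a.1 a.2
      + ∑ a : Fin n × Fin n with a.2 < a.1, f a.1 a.2 := by
    rw [← Fintype.sum_prod_type', Finset.sum_filter, Finset.sum_filter, ← Finset.sum_add_distrib]
    refine Finset.sum_congr rfl fun a _ => ?_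
    rcases lt_trichotomy a.1 a.2 with h | h | h
    · simp [h, h.not_gt]
    · simp [h, h0]
    · simp [h, h.not_gt]
  rw [h2, ← h1]; ring

variable {Ω : V → V → V → V → ℝ}

/-- Both sums over `i < j` become sums over all pairs at the cost of a factor `1/2` each, whence
`1/16 = 1/4 · 1/2 · 1/2`. -/
theorem weitzenboeck_self_eq_sum (h : IsCurvatureLike Ω) {p : ℕ} (ψ : ⋀[ℝ]^p V)
    (b : OrthonormalBasis ι ℝ V) :
    weitzenboeck p Ω ψ ψ = (1 / 16) * ∑ i, ∑ j, ∑ k, ∑ l, Ω (b i) (b j) (b k) (b l) *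
      extInner (ad (vecMul (b i) (b j)) (ψ : ExteriorAlgebra ℝ V))
        (ad (vecMul (b k) (b l)) (ψ : ExteriorAlgebra ℝ V)) := by
  have hq := extInner_ad_isQuadrilinear (V := V) (ψ : ExteriorAlgebra ℝ V)
  rw [sum_quadrilinear_eq b (stdOrthonormalBasis ℝ V) h.isQuadrilinear hq, weitzenboeck]
  set e := stdOrthonormalBasis ℝ V
  have hneg : ∀ a b, a ≠ b → ad (vecMul (e b) (e a)) (ψ : ExteriorAlgebra ℝ V)
      = -ad (vecMul (e a) (e b)) (ψ : ExteriorAlgebra ℝ V) := fun a b hab => by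
    rw [vecMul_swap (e.orthonormal.2 hab), (ad_linear_left (V := V) _).map_neg]
  have h1 : ∀ a : Fin (Module.finrank ℝ V) × Fin (Module.finrank ℝ V), _ := fun a =>
    sum_filter_lt (f := fun c d => Ω (e a.1) (e a.2) (e c) (e d) *
      extInner (ad (vecMul (e a.1) (e a.2)) (ψ : ExteriorAlgebra ℝ V))
        (ad (vecMul (e c) (e d)) (ψ : ExteriorAlgebra ℝ V)))
      (fun c d => by
        by_cases hcd : c = d
        · rw [hcd]
        · rw [hneg c d hcd, (extInner_linear_right (V := V) _).map_neg, h.swap']; ring)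
      (fun c => by rw [h.self_right, zero_mul])
  have h2 := sum_filter_lt (f := fun a b => ∑ c, ∑ d, Ω (e a) (e b) (e c) (e d) *
      extInner (ad (vecMul (e a) (e b)) (ψ : ExteriorAlgebra ℝ V))
        (ad (vecMul (e c) (e d)) (ψ : ExteriorAlgebra ℝ V)))
      (fun a b => by
        by_cases hab : a = b
        · rw [hab]
        · refine Finset.sum_congr rfl fun c _ => Finset.sum_congr rfl fun d _ => ?_
          rw [hneg a b hab, (extInner_linear_left (V := V) _).map_neg, h.swap]; ring)
      (fun a => by simp only [h.self_left, zero_mul, Finset.sum_const_zero])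
  simp only [h1, ← Finset.mul_sum, h2]
  ring

end Weitzenboeck

/-! ### Weitzenböck sectional curvature as a sum of sectional curvatures. -/

section WeitzenboeckSectional

variable {V : Type*} [NormedAddCommGroup V] [InnerProductSpace ℝ V] [FiniteDimensional ℝ V]
variable {Ω : V → V → V → V → ℝ}

/-- The Weitzenböck sectional curvature of the plane spanned by the first `p` vectors of an
orthonormal basis is the sum of the mixed sectional curvatures. -/
theorem weitzenboeck_eq_sum_sectional (h : IsCurvatureLike Ω) {p q : ℕ}
    (b : OrthonormalBasis (Fin p ⊕ Fin q) ℝ V) :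
    weitzenboeck p Ω (exteriorPower.ιMulti ℝ p fun k => b (.inl k))
      (exteriorPower.ιMulti ℝ p fun k => b (.inl k))
      = ∑ i, ∑ j, Ω (b (.inl i)) (b (.inr j)) (b (.inl i)) (b (.inr j)) := by
  have hp : p ≤ Module.finrank ℝ V := by
    rw [Module.finrank_eq_card_basis b.toBasis]; simp
  rw [weitzenboeck_self_eq_sum h _ b]
  have hll := fun i j : Fin p => ad_vecMul_ιMulti b (s := .inl i) (t := .inl j) rfl
  have hrr := fun i j : Fin q => ad_vecMul_ιMulti b (s := .inr i) (t := .inr j) rfl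
  have hz1 := fun a => (extInner_linear_left (V := V) a).map_zero
  have hz2 := fun a => (extInner_linear_right (V := V) a).map_zero
  simp only [Fintype.sum_sum_type, hll, hrr, hz1, hz2, ad_vecMul_ιMulti_inl_inr,
    ad_vecMul_ιMulti_inr_inl, (extInner_linear_left (V := V) _).map_smul,
    (extInner_linear_right (V := V) _).map_smul, extInner_coe hp, inner_replacedWedge]
  -- Each mixed pair survives only against itself, in four orderings. The signs of Ω match those of
  -- `±2`, so each ordering contributes `4Ω`, and the total `16Ω` cancels `1/16`.
  simp only [h.swap' _ _ (b (.inl _)) (b (.inr _)), h.swap (b (.inl _)) (b (.inr _))]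
  simp only [ite_and, smul_eq_mul, mul_ite, mul_one, mul_zero, Finset.sum_const_zero,
    Finset.sum_ite_eq, Finset.mem_univ, if_true, add_zero, zero_add, Finset.sum_ite_irrel]
  rw [Finset.sum_comm (s := (Finset.univ : Finset (Fin q))) (t := (Finset.univ : Finset (Fin p)))]
  simp only [← Finset.sum_add_distrib, Finset.mul_sum]
  refine Finset.sum_congr rfl fun i _ => Finset.sum_congr rfl fun j _ => ?_
  ring

end WeitzenboeckSectional

/-! ### Symmetric matrices with constant sums over `I × Iᶜ`. -/

section Combinatorics

variable {ι : Type*} [Fintype ι] [DecidableEq ι] {K : ι → ι → ℝ} {p : ℕ} {c : ℝ}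

theorem sum_compl_eq (I : Finset ι) :
    ∑ x ∈ I, ∑ y ∈ Iᶜ, K x y = ∑ x ∈ I, ∑ y, K x y - ∑ x ∈ I, ∑ y ∈ I, K x y := by
  rw [← Finset.sum_sub_distrib]
  refine Finset.sum_congr rfl fun x _ => ?_
  rw [← Finset.sum_add_sum_compl I]
  ring

/-- Complete a set `A` of `p - 2` other indices by `{a,j}`, `{b,j}`, `{a,l}` and `{b,l}`. In the
alternating sum of the four conditions everything additive in the two added elements cancels,
leaving only the cross terms `K`. -/
theorem four_term_of_sum_compl_const (hs : ∀ x y, K x y = K y x)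
    (hp : 2 ≤ p) (hpn : p + 2 ≤ Fintype.card ι)
    (hc : ∀ I : Finset ι, I.card = p → ∑ x ∈ I, ∑ y ∈ Iᶜ, K x y = c)
    {a b j l : ι} (hab : a ≠ b) (haj : a ≠ j) (hal : a ≠ l) (hbj : b ≠ j) (hbl : b ≠ l)
    (hjl : j ≠ l) : K a j - K b j = K a l - K b l := by
  have h4 : ({a, b, j, l} : Finset ι).card = 4 := by
    simp [*]
  -- Such an `A` exists because `p + 2 ≤ n` leaves `n - 4 ≥ p - 2` indices.
  obtain ⟨A, hA, hAp⟩ := Finset.exists_subset_card_eq (s := ({a, b, j, l} : Finset ι)ᶜ)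
    (n := p - 2) (by rw [Finset.card_compl, h4]; omega)
  have hm : a ∉ A ∧ b ∉ A ∧ j ∉ A ∧ l ∉ A := by
    refine ⟨?_, ?_, ?_, ?_⟩ <;> intro h <;> simpa using hA h
  obtain ⟨ha, hb, hj, hl⟩ := hm
  have key : ∀ x y, x ≠ y → x ∉ A → y ∉ A →
      (∑ z, K x z) + (∑ z, K y z) + ∑ w ∈ A, ∑ z, K w z
        - (K x x + K y y + 2 * K x y + 2 * (∑ z ∈ A, K x z) + 2 * (∑ z ∈ A, K y z)
          + ∑ w ∈ A, ∑ z ∈ A, K w z) = c := by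
    intro x y hxy hx hy
    have hx' : x ∉ insert y A := by simp [hxy, hx]
    have := hc (insert x (insert y A)) (by
      rw [Finset.card_insert_of_notMem hx', Finset.card_insert_of_notMem hy]; omega)
    rw [sum_compl_eq] at this
    have hA : ∀ z, ∑ w ∈ A, K w z = ∑ w ∈ A, K z w := fun z =>
      Finset.sum_congr rfl fun w _ => hs w z
    simp only [Finset.sum_insert hx', Finset.sum_insert hy, Finset.sum_add_distrib, hA] at this
    rw [hs y x] at this
    linarith
  have e1 := key a j haj ha hj
  have e2 := key b j hbj hb hj
  have e3 := key a l hal ha hl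
  have e4 := key b l hbl hb hl
  linarith

variable (hs : ∀ x y, K x y = K y x) (h0 : ∀ x, K x x = 0)
include hs h0

/-- For the `n - 2` indices `y ≠ a, b` the difference `K a y - K b y` has one common value; the
terms `y = a` and `y = b` cancel by symmetry and the zero diagonal. -/
theorem sum_sub_sum_of_four_term
    (h4 : ∀ a b j l : ι, a ≠ b → a ≠ j → a ≠ l → b ≠ j → b ≠ l → j ≠ l →
      K a j - K b j = K a l - K b l)
    {a b j : ι} (hab : a ≠ b) (haj : a ≠ j) (hbj : b ≠ j) :
    ∑ y, K a y - ∑ y, K b y = ((Fintype.card ι : ℝ) - 2) * (K a j - K b j) := by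
  have hb : b ∈ Finset.univ.erase a := by simp [hab.symm]
  rw [← Finset.sum_sub_distrib, ← Finset.add_sum_erase _ _ (Finset.mem_univ a),
    ← Finset.add_sum_erase _ _ hb, Finset.sum_congr rfl (g := fun _ => K a j - K b j)]
  · rw [Finset.sum_const, Finset.card_erase_of_mem hb, Finset.card_erase_of_mem (Finset.mem_univ a),
      Finset.card_univ, h0, h0, hs b a, nsmul_eq_mul]
    have : 2 ≤ Fintype.card ι := by
      rw [← Finset.card_pair hab]; exact Finset.card_le_univ _
    rw [Nat.sub_sub, Nat.cast_sub this]
    push_cast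
    ring
  · intro y hy
    simp only [Finset.mem_erase, Finset.mem_univ, and_true] at hy
    by_cases hyj : y = j
    · rw [hyj]
    · exact h4 a b y j hab hy.2.symm haj hy.1.symm hbj hyj

/-- By the row-sum formula, `K a y - (r a + r y)/(n-2)` does not depend on `y ≠ a`. -/
theorem eq_of_four_term (hn : 3 ≤ Fintype.card ι)
    (h4 : ∀ a b j l : ι, a ≠ b → a ≠ j → a ≠ l → b ≠ j → b ≠ l → j ≠ l →
      K a j - K b j = K a l - K b l) {a j : ι} (haj : a ≠ j) :
    K a j = (∑ y, K a y + ∑ y, K j y) / ((Fintype.card ι : ℝ) - 2)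
      - (∑ x, ∑ y, K x y) / (((Fintype.card ι : ℝ) - 1) * ((Fintype.card ι : ℝ) - 2)) := by
  have hn' : (3 : ℝ) ≤ Fintype.card ι := by exact_mod_cast hn
  have hn2 : (Fintype.card ι : ℝ) - 2 ≠ 0 := by linarith
  have hn1 : (Fintype.card ι : ℝ) - 1 ≠ 0 := by linarith
  set n : ℝ := (Fintype.card ι : ℝ) with hnn
  set r : ι → ℝ := fun x => ∑ y, K x y with hr
  have h1 : ∀ y, y ≠ a → K a y - (r a + r y) / (n - 2) = K a j - (r a + r j) / (n - 2) := by
    intro y hy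
    by_cases hyj : y = j
    · rw [hyj]
    have := sum_sub_sum_of_four_term hs h0 h4 hyj hy haj.symm
    rw [hs a y, hs a j]
    field_simp
    simp only [hr]
    linarith
  -- Summing over the `n - 1` indices `y ≠ a` determines the constant.
  have h2 := Finset.sum_congr (s₁ := Finset.univ.erase a) rfl
    fun y hy => h1 y (Finset.ne_of_mem_erase hy)
  rw [Finset.sum_const, Finset.card_erase_of_mem (Finset.mem_univ a), Finset.card_univ,
    nsmul_eq_mul, Nat.cast_sub (by omega), Nat.cast_one, ← hnn, Finset.sum_sub_distrib,
    ← Finset.sum_div, Finset.sum_add_distrib, Finset.sum_const,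
    Finset.card_erase_of_mem (Finset.mem_univ a), Finset.card_univ, nsmul_eq_mul,
    Nat.cast_sub (by omega), Nat.cast_one, ← hnn] at h2
  have e1 := Finset.add_sum_erase Finset.univ (K a) (Finset.mem_univ a)
  have e2 := Finset.add_sum_erase Finset.univ r (Finset.mem_univ a)
  rw [h0, zero_add] at e1
  rw [e1] at h2
  have e3 : ∑ x ∈ Finset.univ.erase a, r x = (∑ x, r x) - r a := by linarith
  rw [e3] at h2
  change K a j = (r a + r j) / (n - 2) - (∑ x, r x) / ((n - 1) * (n - 2))
  change r a - _ = _ at h2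
  field_simp at h2 ⊢
  linarith

/-- Comparing `A ∪ {a}` with `A ∪ {b}`, where `A` has `p - 1` elements, gives `r a - r b = 2(p-1)(K
a j - K b j)`. The row-sum formula has `n - 2` in place of `2(p-1)`, so `(n - 2p)(K a j - K b j) =
0`. -/
theorem sum_eq_of_sum_compl_const (hp : 2 ≤ p) (hpn : p + 2 ≤ Fintype.card ι)
    (hc : ∀ I : Finset ι, I.card = p → ∑ x ∈ I, ∑ y ∈ Iᶜ, K x y = c)
    (hne : Fintype.card ι ≠ 2 * p) (a b : ι) : ∑ y, K a y = ∑ y, K b y := by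
  by_cases hab : a = b
  · rw [hab]
  have h4 := fun a b j l h1 h2 h3 h4 h5 h6 =>
    four_term_of_sum_compl_const (a := a) (b := b) (j := j) (l := l) hs hp hpn hc h1 h2 h3 h4 h5 h6
  obtain ⟨A, hA, hAp⟩ := Finset.exists_subset_card_eq (s := ({a, b} : Finset ι)ᶜ)
    (n := p - 1) (by rw [Finset.card_compl, Finset.card_pair hab]; omega)
  have ha : a ∉ A := fun h => by simpa using hA h
  have hb : b ∉ A := fun h => by simpa using hA h
  have key : ∀ x, x ∉ A → (∑ z, K x z) + ∑ w ∈ A, ∑ z, K w z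
        - (2 * (∑ z ∈ A, K x z) + ∑ w ∈ A, ∑ z ∈ A, K w z) = c := by
    intro x hx
    have := hc (insert x A) (by rw [Finset.card_insert_of_notMem hx]; omega)
    rw [sum_compl_eq] at this
    have hA : ∀ z, ∑ w ∈ A, K w z = ∑ w ∈ A, K z w := fun z =>
      Finset.sum_congr rfl fun w _ => hs w z
    simp only [Finset.sum_insert hx, Finset.sum_add_distrib, hA, h0] at this
    linarith
  -- Here `p ≥ 2` matters: the comparison index `j` is taken inside `A`.
  obtain ⟨j, hj⟩ : A.Nonempty := Finset.card_pos.1 (by omega)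
  have hja : a ≠ j := by rintro rfl; exact ha hj
  have hjb : b ≠ j := by rintro rfl; exact hb hj
  have e1 := sum_sub_sum_of_four_term hs h0 h4 hab hja hjb
  have e2 : ∑ z ∈ A, K a z - ∑ z ∈ A, K b z = ((p : ℝ) - 1) * (K a j - K b j) := by
    rw [← Finset.sum_sub_distrib, Finset.sum_congr rfl (g := fun _ => K a j - K b j),
      Finset.sum_const, hAp, nsmul_eq_mul, Nat.cast_sub (by omega), Nat.cast_one]
    intro y hy
    by_cases hyj : y = j
    · rw [hyj]
    · refine h4 a b y j hab ?_ hja ?_ hjb hyj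
      · rintro rfl; exact ha hy
      · rintro rfl; exact hb hy
  have e3 := key a ha
  have e4 := key b hb
  have e5 : ((Fintype.card ι : ℝ) - 2 * p) * (K a j - K b j) = 0 := by
    linear_combination e3 - e4 - e1 + 2 * e2
  have e6 : (Fintype.card ι : ℝ) - 2 * p ≠ 0 := sub_ne_zero.2 (by exact_mod_cast hne)
  have e7 := (mul_eq_zero.1 e5).resolve_left e6
  rw [e7, mul_zero] at e1
  linarith

end Combinatorics

/-! ### The equivalence at a single point. -/

section Pointwise

variable {V : Type*} [NormedAddCommGroup V] [InnerProductSpace ℝ V] [FiniteDimensional ℝ V]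
variable {Ω : V → V → V → V → ℝ}

theorem exists_orthonormalBasis_extending {ι κ : Type*} [Fintype ι]
    (hι : Module.finrank ℝ V = Fintype.card ι) (f : κ ↪ ι) {e : κ → V} (he : Orthonormal ℝ e) :
    ∃ b : OrthonormalBasis ι ℝ V, ∀ k, b (f k) = e k := by
  classical
  -- The default value 0 plays no role: only the restriction to the range of `f` is extended to a
  -- basis.
  have hinv : ∀ k, Function.extend f e 0 (f k) = e k := fun k => f.injective.extend_apply _ _ _
  have ho : Orthonormal ℝ ((Set.range f).domRestrict (Function.extend f e 0)) := by
    rw [orthonormal_iff_ite] at he ⊢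
    rintro ⟨_, k, rfl⟩ ⟨_, k', rfl⟩
    simp [Set.domRestrict, hinv, he, Subtype.ext_iff]
  obtain ⟨b, hb⟩ := ho.exists_orthonormalBasis_extension_of_card_eq hι
  exact ⟨b, fun k => (hb _ ⟨k, rfl⟩).trans (hinv k)⟩

/-- The Weitzenböck sectional curvature of order `p` of `Ω` takes the only value `c`. -/
def HasWeitzenboeckSectional (p : ℕ) (Ω : V → V → V → V → ℝ) (c : ℝ) : Prop :=
  ∀ e : Fin p → V, Orthonormal ℝ e →
    weitzenboeck p Ω (exteriorPower.ιMulti ℝ p e) (exteriorPower.ιMulti ℝ p e) = c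

theorem hasWeitzenboeckSectional_iff (h : IsCurvatureLike Ω) {p q : ℕ} {c : ℝ}
    (hpq : Module.finrank ℝ V = p + q) :
    HasWeitzenboeckSectional p Ω c ↔ ∀ b : OrthonormalBasis (Fin p ⊕ Fin q) ℝ V,
      ∑ i, ∑ j, Ω (b (.inl i)) (b (.inr j)) (b (.inl i)) (b (.inr j)) = c := by
  constructor
  · intro H b
    rw [← weitzenboeck_eq_sum_sectional h]
    exact H _ (b.orthonormal.comp _ Sum.inl_injective)
  · intro H e he
    obtain ⟨b, hb⟩ := exists_orthonormalBasis_extending (ι := Fin p ⊕ Fin q) (by simpa using hpq)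
      ⟨Sum.inl, Sum.inl_injective⟩ he
    obtain rfl : (fun k => b (.inl k)) = e := funext hb
    rw [weitzenboeck_eq_sum_sectional h, H]

/-- Listing the vectors indexed by `I` before the others brings the hypothesis into the form
required by the combinatorial lemmas, with one fixed basis and varying `I`. -/
theorem HasWeitzenboeckSectional.sum_compl (h : IsCurvatureLike Ω) {n p : ℕ} {c : ℝ}
    (hV : Module.finrank ℝ V = n) (H : HasWeitzenboeckSectional p Ω c) (hpn : p ≤ n)
    (b : OrthonormalBasis (Fin n) ℝ V) (I : Finset (Fin n)) (hI : I.card = p) :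
    ∑ x ∈ I, ∑ y ∈ Iᶜ, Ω (b x) (b y) (b x) (b y) = c := by
  have hI' : Iᶜ.card = n - p := by rw [Finset.card_compl, hI, Fintype.card_fin]
  rw [hasWeitzenboeckSectional_iff h (q := n - p) (by omega)] at H
  rw [← H (b.reindex (finSumEquivOfFinset hI hI').symm)]
  simp only [OrthonormalBasis.reindex_apply, Equiv.symm_symm, finSumEquivOfFinset_inl,
    finSumEquivOfFinset_inr]
  have hsum : ∀ {m : ℕ} (J : Finset (Fin n)) (hJ : J.card = m) (f : Fin n → ℝ),
      ∑ x ∈ J, f x = ∑ i, f (J.orderEmbOfFin hJ i) := fun J hJ f => by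
    conv_lhs => rw [← Finset.map_orderEmbOfFin_univ J hJ, Finset.sum_map]
    rfl
  rw [hsum I hI]
  exact Finset.sum_congr rfl fun i _ => hsum Iᶜ hI' _

/-- Applies the combinatorics to the sectional curvature matrix of a basis starting with `e 0, e 1`:
its row sums are Ricci values and its total is the scalar curvature. Equal row sums must each be
`scalar Ω / n`. -/
theorem HasWeitzenboeckSectional.sectional_eq (h : IsCurvatureLike Ω) {n p : ℕ} {c : ℝ}
    (hV : Module.finrank ℝ V = n) (H : HasWeitzenboeckSectional p Ω c) (hp : 2 ≤ p)
    (hpn : p + 2 ≤ n) {e : Fin 2 → V} (he : Orthonormal ℝ e) :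
    Ω (e 0) (e 1) (e 0) (e 1) = (ricci Ω (e 0) (e 0) + ricci Ω (e 1) (e 1)) / ((n : ℝ) - 2)
        - scalar Ω / (((n : ℝ) - 1) * ((n : ℝ) - 2)) ∧
      (n ≠ 2 * p → ricci Ω (e 0) (e 0) = scalar Ω / n ∧ ricci Ω (e 1) (e 1) = scalar Ω / n) := by
  have hn2 : 2 ≤ n := by omega
  obtain ⟨b, hb⟩ := exists_orthonormalBasis_extending (ι := Fin n) (by simpa using hV)
    (Fin.castLEEmb hn2) he
  have hS := H.sum_compl h hV (by omega) b
  have hs : ∀ x y, Ω (b x) (b y) (b x) (b y) = Ω (b y) (b x) (b y) (b x) := fun x y => by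
    rw [h.swap (b y) (b x), h.swap' (b y) (b x)]; ring
  have h0 : ∀ x, Ω (b x) (b x) (b x) (b x) = 0 := fun x => h.self_left _ _ _
  have hcard : p + 2 ≤ Fintype.card (Fin n) := by simpa using hpn
  have h4 := fun a b j l h1 h2 h3 h4 h5 h6 => four_term_of_sum_compl_const
    (a := a) (b := b) (j := j) (l := l) hs hp hcard hS h1 h2 h3 h4 h5 h6
  have hr := fun u w => ricci_eq_sum h.isQuadrilinear b u w
  have hsc := scalar_eq_sum h.isQuadrilinear b
  have hne : Fin.castLEEmb hn2 0 ≠ Fin.castLEEmb hn2 1 := by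
    rw [Ne, (Fin.castLEEmb hn2).apply_eq_iff_eq]; decide
  have key := eq_of_four_term hs h0 (by simp; omega) h4 hne
  have hsum := sum_eq_of_sum_compl_const hs h0 hp hcard hS
  simp only [← hr, ← hsc, hb, Fintype.card_fin] at key hsum
  refine ⟨key, fun hnp => ?_⟩
  have hall : ∀ a, ricci Ω (b a) (b a) = scalar Ω / n := by
    intro a
    rw [hsc, Finset.sum_congr rfl fun x _ => hsum hnp x a, Finset.sum_const, Finset.card_univ,
      Fintype.card_fin, nsmul_eq_mul, mul_div_cancel_left₀]
    exact_mod_cast (by omega : n ≠ 0)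
  exact ⟨hb 0 ▸ hall _, hb 1 ▸ hall _⟩

/-- On an orthonormal pair the formula of `sectional_eq` says exactly that the Weyl tensor vanishes.
-/
theorem HasWeitzenboeckSectional.weyl_eq_zero (h : IsCurvatureLike Ω) {n p : ℕ} {c : ℝ}
    (hV : Module.finrank ℝ V = n) (H : HasWeitzenboeckSectional p Ω c) (hp : 2 ≤ p)
    (hpn : p + 2 ≤ n) (u v w z : V) : weyl Ω u v w z = 0 := by
  refine (weyl_isCurvatureLike h).eq_zero_of_orthonormal (fun e he => ?_) u v w z
  have e1 := (H.sectional_eq h hV hp hpn he).1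
  have h1 := orthonormal_iff_ite.1 he
  rw [weyl, hV, e1]
  simp [h1, he.1]

theorem HasWeitzenboeckSectional.sectional_const (h : IsCurvatureLike Ω) {n p : ℕ} {c : ℝ}
    (hV : Module.finrank ℝ V = n) (H : HasWeitzenboeckSectional p Ω c) (hp : 2 ≤ p)
    (hpn : p + 2 ≤ n) (hnp : n ≠ 2 * p) :
    ∃ κ : ℝ, ∀ e : Fin 2 → V, Orthonormal ℝ e → Ω (e 0) (e 1) (e 0) (e 1) = κ := by
  refine ⟨(scalar Ω / n + scalar Ω / n) / ((n : ℝ) - 2)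
    - scalar Ω / (((n : ℝ) - 1) * ((n : ℝ) - 2)), fun e he => ?_⟩
  have e1 := H.sectional_eq h hV hp hpn he
  rw [e1.1, (e1.2 hnp).1, (e1.2 hnp).2]

theorem hasWeitzenboeckSectional_of_sectional_const (h : IsCurvatureLike Ω) {p : ℕ} {κ : ℝ}
    (hpn : p ≤ Module.finrank ℝ V)
    (hκ : ∀ e : Fin 2 → V, Orthonormal ℝ e → Ω (e 0) (e 1) (e 0) (e 1) = κ) :
    ∃ c, HasWeitzenboeckSectional p Ω c := by
  obtain ⟨q, hq⟩ := Nat.exists_eq_add_of_le hpn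
  refine ⟨∑ _i : Fin p, ∑ _j : Fin q, κ, (hasWeitzenboeckSectional_iff h hq).2 fun b => ?_⟩
  refine Finset.sum_congr rfl fun i _ => Finset.sum_congr rfl fun j _ => ?_
  refine hκ ![b (.inl i), b (.inr j)] ?_
  convert b.orthonormal.comp ![.inl i, .inr j] ?_ using 1
  · ext k; fin_cases k <;> rfl
  · intro k k' hk
    fin_cases k <;> fin_cases k' <;> simp_all

/-- Since `n = 2p`, each basis vector, inside or outside the plane, lies in exactly `p` mixed pairs.
The Ricci terms therefore add up to `p` times the scalar curvature for every plane. -/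
theorem hasWeitzenboeckSectional_of_weyl_eq_zero (h : IsCurvatureLike Ω) {p : ℕ}
    (hV : Module.finrank ℝ V = 2 * p) (hW : ∀ u v w z, weyl Ω u v w z = 0) :
    ∃ c, HasWeitzenboeckSectional p Ω c := by
  refine ⟨p * scalar Ω / ((2 * p : ℝ) - 2)
    - p * (p * (scalar Ω / (((2 * p : ℝ) - 1) * ((2 * p : ℝ) - 2)))),
    (hasWeitzenboeckSectional_iff h (q := p) (by omega)).2 fun b => ?_⟩
  have hb := orthonormal_iff_ite.1 b.orthonormal
  have key : ∀ i j : Fin p, Ω (b (.inl i)) (b (.inr j)) (b (.inl i)) (b (.inr j))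
      = (ricci Ω (b (.inl i)) (b (.inl i)) + ricci Ω (b (.inr j)) (b (.inr j)))
        / ((2 * p : ℝ) - 2) - scalar Ω / (((2 * p : ℝ) - 1) * ((2 * p : ℝ) - 2)) := by
    intro i j
    have := hW (b (.inl i)) (b (.inr j)) (b (.inl i)) (b (.inr j))
    rw [weyl, hV] at this
    simp [hb] at this
    linarith
  simp only [key, Finset.sum_sub_distrib, ← Finset.sum_div, Finset.sum_add_distrib,
    Finset.sum_const, Finset.card_univ, Fintype.card_fin, nsmul_eq_mul,
    scalar_eq_sum h.isQuadrilinear b, Fintype.sum_sum_type, ← Finset.mul_sum]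
  ring

end Pointwise

/-! ### Levi-Civita connections on open sets, and Schur's lemma. -/

section LocalGeometry

set_option maxSynthPendingDepth 3
set_option synthInstance.maxHeartbeats 200000

variable {E F : Type*} [NormedAddCommGroup E] [NormedSpace ℝ E] [NormedAddCommGroup F]
  [NormedSpace ℝ F]

/-- `Γ` is the Christoffel map of the metric `g` on the open set `U`. -/
structure IsLeviCivita (g : E → E →L[ℝ] E →L[ℝ] ℝ) (Γ : E → E →L[ℝ] E →L[ℝ] E) (U : Set E) :
    Prop where
  isOpen : IsOpen U
  g_symm : ∀ y ∈ U, ∀ u v, g y u v = g y v u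
  g_pos : ∀ y ∈ U, ∀ u, u ≠ 0 → 0 < g y u u
  g_smooth : ContDiffOn ℝ ∞ g U
  Γ_smooth : ContDiffOn ℝ ∞ Γ U
  Γ_symm : ∀ y ∈ U, ∀ u v, Γ y u v = Γ y v u
  compat : ∀ y ∈ U, ∀ u v w, fderiv ℝ g y u v w = g y (Γ y u v) w + g y v (Γ y u w)

/-- The curvature operator `R(u, v) z` of the connection with Christoffel map `Γ`. -/
def curvOp (Γ : E → E →L[ℝ] E →L[ℝ] E) (y u v z : E) : E :=
  fderiv ℝ Γ y u v z - fderiv ℝ Γ y v u z + Γ y u (Γ y v z) - Γ y v (Γ y u z)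

theorem fderiv_clm_apply_apply {c : E → E →L[ℝ] E →L[ℝ] F} {a b : E → E} {y : E}
    (hc : DifferentiableAt ℝ c y) (ha : DifferentiableAt ℝ a y) (hb : DifferentiableAt ℝ b y)
    (u : E) :
    fderiv ℝ (fun y => c y (a y) (b y)) y u
      = fderiv ℝ c y u (a y) (b y) + c y (fderiv ℝ a y u) (b y) + c y (a y) (fderiv ℝ b y u) := by
  rw [((hc.hasFDerivAt.clm_apply ha.hasFDerivAt).clm_apply hb.hasFDerivAt).fderiv]
  simp
  abel

theorem fderiv_clm_apply_const {c : E → E →L[ℝ] E →L[ℝ] F} {y : E}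
    (hc : DifferentiableAt ℝ c y) (u v w : E) :
    fderiv ℝ (fun y => c y v w) y u = fderiv ℝ c y u v w := by
  rw [fderiv_clm_apply_apply hc (differentiableAt_const v) (differentiableAt_const w)]
  simp

theorem fderiv_fderiv_symm {f : E → F} {U : Set E} (hU : IsOpen U) (hf : ContDiffOn ℝ ∞ f U)
    {y : E} (hy : y ∈ U) (u v : E) :
    fderiv ℝ (fderiv ℝ f) y u v = fderiv ℝ (fderiv ℝ f) y v u :=
  ((hf.contDiffAt (hU.mem_nhds hy)).isSymmSndFDerivAt
    (by simpa using WithTop.coe_le_coe.2 (le_top : (2 : ℕ∞) ≤ ⊤))) u v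

theorem contDiffOn_fderiv {f : E → F} {U : Set E} (hU : IsOpen U) (hf : ContDiffOn ℝ ∞ f U) :
    ContDiffOn ℝ ∞ (fderiv ℝ f) U :=
  hf.fderiv_of_isOpen hU (by simp)

theorem ContDiffOn.differentiableAt_of_mem {f : E → F} {U : Set E} (hf : ContDiffOn ℝ ∞ f U)
    (hU : IsOpen U) {y : E} (hy : y ∈ U) : DifferentiableAt ℝ f y :=
  (hf.contDiffAt (hU.mem_nhds hy)).differentiableAt (by simp)

theorem fderiv_clm_apply_const_one {c : E → E →L[ℝ] F} {y : E}
    (hc : DifferentiableAt ℝ c y) (u v : E) :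
    fderiv ℝ (fun y => c y v) y u = fderiv ℝ c y u v := by
  rw [(hc.hasFDerivAt.clm_apply (hasFDerivAt_const v y)).fderiv]
  simp

theorem curvOp_swap (Γ : E → E →L[ℝ] E →L[ℝ] E) (y u v z : E) :
    curvOp Γ y v u z = -curvOp Γ y u v z := by
  simp only [curvOp]; abel

theorem curvOp_add (Γ : E → E →L[ℝ] E →L[ℝ] E) (y u u' v z : E) :
    curvOp Γ y (u + u') v z = curvOp Γ y u v z + curvOp Γ y u' v z := by
  simp only [curvOp, map_add, add_apply]; abel

theorem curvOp_smul (Γ : E → E →L[ℝ] E →L[ℝ] E) (c : ℝ) (y u v z : E) :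
    curvOp Γ y (c • u) v z = c • curvOp Γ y u v z := by
  simp only [curvOp, map_smul, smul_apply]; module

/-- Four Bianchi identities combined with the two skew symmetries. The cyclic sum leaves the third
slot fixed because there `R u v w z` stands for `g(w, R(u,v)z)`. -/
theorem pair_symm_of_bianchi {α : Type*} {R : α → α → α → α → ℝ}
    (h12 : ∀ u v w z, R v u w z = -R u v w z)
    (h34 : ∀ u v w z, R u v z w = -R u v w z)
    (hB : ∀ u v w z, R u v w z + R v z w u + R z u w v = 0) (u v w z : α) :
    R w z u v = R u v w z := by
  have b1 := hB u v w z
  have b2 := hB u v z w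
  have b3 := hB w z u v
  have b4 := hB w z v u
  linarith [h12 u v w z, h12 u v z w, h12 w z u v, h12 w z v u, h34 u v w z, h34 w z u v,
    h12 u w v z, h12 u w z v, h34 u w v z, h34 w u v z, h12 u z v w, h12 u z w v, h34 u z v w,
    h34 z u v w, h12 v w u z, h12 v w z u, h34 v w u z, h34 w v u z, h12 v z u w, h12 v z w u,
    h34 v z u w, h34 z v u w]

namespace IsLeviCivita

variable {g : E → E →L[ℝ] E →L[ℝ] ℝ} {Γ : E → E →L[ℝ] E →L[ℝ] E} {U : Set E}

theorem mono (h : IsLeviCivita g Γ U) {V : Set E} (hV : IsOpen V) (hVU : V ⊆ U) :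
    IsLeviCivita g Γ V where
  isOpen := hV
  g_symm y hy := h.g_symm y (hVU hy)
  g_pos y hy := h.g_pos y (hVU hy)
  g_smooth := h.g_smooth.mono hVU
  Γ_smooth := h.Γ_smooth.mono hVU
  Γ_symm y hy := h.Γ_symm y (hVU hy)
  compat y hy := h.compat y (hVU hy)

variable (h : IsLeviCivita g Γ U) {y : E} (hy : y ∈ U)
include h hy

theorem g_diff : DifferentiableAt ℝ g y := ContDiffOn.differentiableAt_of_mem h.g_smooth h.isOpen hy

theorem Γ_diff : DifferentiableAt ℝ Γ y := ContDiffOn.differentiableAt_of_mem h.Γ_smooth h.isOpen hy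

theorem dΓ_diff : DifferentiableAt ℝ (fderiv ℝ Γ) y :=
  ContDiffOn.differentiableAt_of_mem (contDiffOn_fderiv h.isOpen h.Γ_smooth) h.isOpen hy

theorem dΓ_symm (u v w : E) : fderiv ℝ Γ y u v w = fderiv ℝ Γ y u w v := by
  rw [← fderiv_clm_apply_const (h.Γ_diff hy), ← fderiv_clm_apply_const (h.Γ_diff hy)]
  have : (fun y => Γ y v w) =ᶠ[nhds y] fun y => Γ y w v := by
    filter_upwards [h.isOpen.mem_nhds hy] with y hy using h.Γ_symm y hy v w
  rw [this.fderiv_eq]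

/-- No torsion: symmetry of `Γ` and of its derivative makes the cyclic sum cancel in pairs. -/
theorem curvOp_bianchi (u v z : E) :
    curvOp Γ y u v z + curvOp Γ y v z u + curvOp Γ y z u v = 0 := by
  simp only [curvOp]
  rw [h.dΓ_symm hy u v z, h.dΓ_symm hy v u z, h.dΓ_symm hy z v u, h.Γ_symm y hy v z,
    h.Γ_symm y hy z u, h.Γ_symm y hy v u]
  abel

/-- Differentiating metric compatibility once more expresses the second derivative of `g` through
`Γ`; its symmetry in `u, v` is the skewness of the curvature operator. -/
theorem curvOp_skew (u v z w : E) :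
    g y (curvOp Γ y u v z) w + g y z (curvOp Γ y u v w) = 0 := by
  have key : ∀ u v : E, fderiv ℝ (fderiv ℝ g) y u v z w
      = g y (Γ y u (Γ y v z)) w + g y (Γ y v z) (Γ y u w) + g y (fderiv ℝ Γ y u v z) w
        + (g y (Γ y u z) (Γ y v w) + g y z (Γ y u (Γ y v w)) + g y z (fderiv ℝ Γ y u v w)) := by
    intro u v
    have hdg : DifferentiableAt ℝ (fderiv ℝ g) y :=
      ContDiffOn.differentiableAt_of_mem (contDiffOn_fderiv h.isOpen h.g_smooth) h.isOpen hy
    have hΓ : ∀ a b : E, DifferentiableAt ℝ (fun y => Γ y a b) y := fun a b =>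
      ((h.Γ_diff hy).clm_apply (differentiableAt_const a)).clm_apply (differentiableAt_const b)
    have hg : ∀ {a b : E → E}, DifferentiableAt ℝ a y → DifferentiableAt ℝ b y →
        DifferentiableAt ℝ (fun y => g y (a y) (b y)) y := fun ha hb =>
      ((h.g_diff hy).clm_apply ha).clm_apply hb
    have e1 : fderiv ℝ (fun y => fderiv ℝ g y v z w) y u = fderiv ℝ (fderiv ℝ g) y u v z w := by
      have : DifferentiableAt ℝ (fun y => fderiv ℝ g y v) y :=
        hdg.clm_apply (differentiableAt_const v)
      rw [fderiv_clm_apply_const this, fderiv_clm_apply_const_one hdg]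
    have e2 : (fun y => fderiv ℝ g y v z w)
        =ᶠ[nhds y] fun y => g y (Γ y v z) w + g y z (Γ y v w) := by
      filter_upwards [h.isOpen.mem_nhds hy] with y hy using h.compat y hy v z w
    rw [← e1, e2.fderiv_eq, fderiv_fun_add (hg (hΓ _ _) (differentiableAt_const _))
        (hg (differentiableAt_const _) (hΓ _ _)), add_apply,
      fderiv_clm_apply_apply (h.g_diff hy) (hΓ _ _) (differentiableAt_const _),
      fderiv_clm_apply_apply (h.g_diff hy) (differentiableAt_const _) (hΓ _ _),
      fderiv_clm_apply_const (h.Γ_diff hy), fderiv_clm_apply_const (h.Γ_diff hy),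
      h.compat y hy, h.compat y hy]
    simp
  have e := fderiv_fderiv_symm h.isOpen h.g_smooth hy u v
  have e' := congrArg (fun L : E →L[ℝ] E →L[ℝ] ℝ => L z w) e
  simp only [key] at e'
  simp only [curvOp, map_add, map_sub, add_apply,
    sub_apply]
  linarith

/-- The second Bianchi identity. -/
theorem curvOp_bianchi_second (u v w z : E) :
    (fderiv ℝ (fun y => curvOp Γ y v w z) y u + Γ y u (curvOp Γ y v w z)
        - curvOp Γ y v w (Γ y u z))
      + (fderiv ℝ (fun y => curvOp Γ y w u z) y v + Γ y v (curvOp Γ y w u z)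
        - curvOp Γ y w u (Γ y v z))
      + (fderiv ℝ (fun y => curvOp Γ y u v z) y w + Γ y w (curvOp Γ y u v z)
        - curvOp Γ y u v (Γ y w z)) = 0 := by
  have hΓ : ∀ a b : E, DifferentiableAt ℝ (fun y => Γ y a b) y := fun a b =>
    ((h.Γ_diff hy).clm_apply (differentiableAt_const a)).clm_apply (differentiableAt_const b)
  have hd : ∀ a b c : E, DifferentiableAt ℝ (fun y => fderiv ℝ Γ y a b c) y := fun a b c =>
    (((h.dΓ_diff hy).clm_apply (differentiableAt_const a)).clm_apply
      (differentiableAt_const b)).clm_apply (differentiableAt_const c)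
  have hΓΓ : ∀ a b c : E, DifferentiableAt ℝ (fun y => Γ y a (Γ y b c)) y := fun a b c =>
    ((h.Γ_diff hy).clm_apply (differentiableAt_const a)).clm_apply (hΓ b c)
  -- The covariant derivative's terms in the two form slots are absent from the statement: they
  -- cancel cyclically by symmetry of `Γ`. The second derivatives of `Γ` cancel by their own
  -- symmetry.
  have key : ∀ u v w : E, fderiv ℝ (fun y => curvOp Γ y v w z) y u
      = fderiv ℝ (fderiv ℝ Γ) y u v w z - fderiv ℝ (fderiv ℝ Γ) y u w v z
        + (fderiv ℝ Γ y u v (Γ y w z) + Γ y v (fderiv ℝ Γ y u w z))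
        - (fderiv ℝ Γ y u w (Γ y v z) + Γ y w (fderiv ℝ Γ y u v z)) := by
    intro u v w
    have e1 : ∀ a b, fderiv ℝ (fun y => fderiv ℝ Γ y a b z) y u
        = fderiv ℝ (fderiv ℝ Γ) y u a b z := fun a b => by
      have : DifferentiableAt ℝ (fun y => fderiv ℝ Γ y a) y :=
        (h.dΓ_diff hy).clm_apply (differentiableAt_const a)
      rw [fderiv_clm_apply_const this, fderiv_clm_apply_const_one (h.dΓ_diff hy)]
    have e2 : ∀ a b, fderiv ℝ (fun y => Γ y a (Γ y b z)) y u
        = fderiv ℝ Γ y u a (Γ y b z) + Γ y a (fderiv ℝ Γ y u b z) := fun a b => by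
      rw [fderiv_clm_apply_apply (h.Γ_diff hy) (differentiableAt_const a) (hΓ b z),
        fderiv_clm_apply_const (h.Γ_diff hy)]
      simp
    simp only [curvOp]
    rw [fderiv_fun_sub (((hd v w z).fun_sub (hd w v z)).fun_add (hΓΓ v w z)) (hΓΓ w v z),
      fderiv_fun_add ((hd v w z).fun_sub (hd w v z)) (hΓΓ v w z),
      fderiv_fun_sub (hd v w z) (hd w v z)]
    simp only [add_apply, sub_apply, e1, e2]
  have hsym : ∀ u v, fderiv ℝ (fderiv ℝ Γ) y u v = fderiv ℝ (fderiv ℝ Γ) y v u :=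
    fderiv_fderiv_symm h.isOpen h.Γ_smooth hy
  rw [key, key, key, hsym v u, hsym w u, hsym w v]
  simp only [curvOp, map_add, map_sub]
  abel

theorem curvature_pair (u v w z : E) :
    g y u (curvOp Γ y w z v) = g y w (curvOp Γ y u v z) := by
  refine pair_symm_of_bianchi (R := fun u v w z => g y w (curvOp Γ y u v z)) ?_ ?_ ?_ u v w z
  · intro u v w z
    simp only [curvOp_swap Γ y u v, map_neg]
  · intro u v w z
    have := h.curvOp_skew hy u v w z
    rw [h.g_symm y hy] at this
    linarith
  · intro u v w z
    rw [← map_add, ← map_add, h.curvOp_bianchi hy, map_zero]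

theorem curvature_bianchi (u v w z : E) :
    g y w (curvOp Γ y u v z) + g y u (curvOp Γ y v w z) + g y v (curvOp Γ y w u z) = 0 := by
  have hs : ∀ a b c d, g y a (curvOp Γ y b c d) = -g y d (curvOp Γ y b c a) := fun a b c d => by
    have := h.curvOp_skew hy b c d a
    rw [h.g_symm y hy] at this
    linarith
  rw [hs w, hs u, hs v, ← neg_add, ← neg_add, ← map_add, ← map_add, h.curvOp_bianchi hy, map_zero,
    neg_zero]

end IsLeviCivita

section Transformation

variable {g g' : E → E →L[ℝ] E →L[ℝ] ℝ} {Γ Γ' : E → E →L[ℝ] E →L[ℝ] E} {U U' : Set E}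
  {φ : E → E}

/-- Uniqueness of the Levi-Civita connection: the difference `T` of the two sides is symmetric in
`u, v`, while `g(T(u,v), Jw)` is skew in `v, w`, which forces it to vanish. -/
theorem IsLeviCivita.christoffel_transform (h : IsLeviCivita g Γ U) (h' : IsLeviCivita g' Γ' U')
    (hφ : ContDiffOn ℝ ∞ φ U') (hm : Set.MapsTo φ U' U)
    (hg : ∀ y ∈ U', ∀ u v, g' y u v = g (φ y) (fderiv ℝ φ y u) (fderiv ℝ φ y v))
    (hs : ∀ y ∈ U', Function.Surjective (fderiv ℝ φ y)) {y : E} (hy : y ∈ U') (u v : E) :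
    fderiv ℝ φ y (Γ' y u v)
      = fderiv ℝ (fderiv ℝ φ) y u v + Γ (φ y) (fderiv ℝ φ y u) (fderiv ℝ φ y v) := by
  have hφd : DifferentiableAt ℝ φ y := ContDiffOn.differentiableAt_of_mem hφ h'.isOpen hy
  have hdφ : DifferentiableAt ℝ (fderiv ℝ φ) y :=
    ContDiffOn.differentiableAt_of_mem (contDiffOn_fderiv h'.isOpen hφ) h'.isOpen hy
  have hgd := h.g_diff (hm hy)
  set J := fderiv ℝ φ y with hJ
  set H := fderiv ℝ (fderiv ℝ φ) y with hH
  have hHs : ∀ u v, H u v = H v u := fderiv_fderiv_symm h'.isOpen hφ hy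
  -- The derivative of the pullback metric is computed in two ways, from `Γ'` and from `Γ` by the
  -- chain rule.
  have hcompat : ∀ u v w, g (φ y) (J (Γ' y u v)) (J w) + g (φ y) (J v) (J (Γ' y u w))
      = g (φ y) (H u v + Γ (φ y) (J u) (J v)) (J w)
        + g (φ y) (J v) (H u w + Γ (φ y) (J u) (J w)) := by
    intro u v w
    have e1 := h'.compat y hy u v w
    rw [hg y hy, hg y hy] at e1
    have e2 : (fun y => g' y v w)
        =ᶠ[nhds y] fun y => (g (φ y)) (fderiv ℝ φ y v) (fderiv ℝ φ y w) := by
      filter_upwards [h'.isOpen.mem_nhds hy] with y hy using hg y hy v w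
    have hgφ : HasFDerivAt (fun y => g (φ y)) ((fderiv ℝ g (φ y)).comp J) y :=
      hgd.hasFDerivAt.comp y hφd.hasFDerivAt
    rw [← fderiv_clm_apply_const (h'.g_diff hy), e2.fderiv_eq,
      fderiv_clm_apply_apply (c := fun y => g (φ y)) hgφ.differentiableAt
        (hdφ.clm_apply (differentiableAt_const v)) (hdφ.clm_apply (differentiableAt_const w)),
      hgφ.fderiv, ContinuousLinearMap.comp_apply, h.compat _ (hm hy),
      fderiv_clm_apply_const_one hdφ, fderiv_clm_apply_const_one hdφ] at e1
    rw [← e1]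
    simp only [map_add, add_apply]
    ring
  set T : E → E → E := fun u v => J (Γ' y u v) - (H u v + Γ (φ y) (J u) (J v)) with hT
  have hTs : ∀ u v, T u v = T v u := fun u v => by
    simp only [hT]
    rw [h'.Γ_symm y hy u v, hHs u v, h.Γ_symm _ (hm hy) (J u) (J v)]
  have hTc : ∀ u v w, g (φ y) (T u v) (J w) = -g (φ y) (T u w) (J v) := fun u v w => by
    have e := hcompat u v w
    have e1 : g (φ y) (T u v) (J w) = g (φ y) (J (Γ' y u v)) (J w)
        - g (φ y) (H u v + Γ (φ y) (J u) (J v)) (J w) := by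
      simp only [hT, map_sub, sub_apply]
    have e2 : g (φ y) (T u w) (J v) = g (φ y) (J v) (J (Γ' y u w))
        - g (φ y) (J v) (H u w + Γ (φ y) (J u) (J w)) := by
      rw [h.g_symm _ (hm hy)]
      simp only [hT, map_sub]
    rw [e1, e2]
    linarith
  have hT0 : ∀ w, g (φ y) (T u v) (J w) = 0 := fun w => by
    have e1 := hTc u v w
    rw [hTs u w, hTc w u v, hTs w v, hTc v w u, hTs v u] at e1
    linarith
  -- Surjectivity of the derivative allows testing `T u v` against itself.
  obtain ⟨w, hw⟩ := hs y hy (T u v)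
  have := hT0 w
  rw [← hJ] at hw
  rw [hw] at this
  by_contra hne
  exact (h.g_pos _ (hm hy) _ (sub_ne_zero.2 hne)).ne' this

/-- Differentiate the transformation law of `Γ` and antisymmetrize: the third derivatives of `φ`
drop out by symmetry, and the remaining terms with second derivatives cancel. -/
theorem IsLeviCivita.curvOp_transform (h : IsLeviCivita g Γ U) (h' : IsLeviCivita g' Γ' U')
    (hφ : ContDiffOn ℝ ∞ φ U') (hm : Set.MapsTo φ U' U)
    (hg : ∀ y ∈ U', ∀ u v, g' y u v = g (φ y) (fderiv ℝ φ y u) (fderiv ℝ φ y v))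
    (hs : ∀ y ∈ U', Function.Surjective (fderiv ℝ φ y)) {y : E} (hy : y ∈ U') (u v z : E) :
    fderiv ℝ φ y (curvOp Γ' y u v z)
      = curvOp Γ (φ y) (fderiv ℝ φ y u) (fderiv ℝ φ y v) (fderiv ℝ φ y z) := by
  have hφd : DifferentiableAt ℝ φ y := ContDiffOn.differentiableAt_of_mem hφ h'.isOpen hy
  have hdφ' := contDiffOn_fderiv h'.isOpen hφ
  have hdφ : DifferentiableAt ℝ (fderiv ℝ φ) y :=
    ContDiffOn.differentiableAt_of_mem hdφ' h'.isOpen hy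
  have hddφ : DifferentiableAt ℝ (fderiv ℝ (fderiv ℝ φ)) y :=
    ContDiffOn.differentiableAt_of_mem (contDiffOn_fderiv h'.isOpen hdφ') h'.isOpen hy
  have ht := fun {y} (hy : y ∈ U') => h.christoffel_transform h' hφ hm hg hs hy
  have hΓd := h.Γ_diff (hm hy)
  have hΓ'd := h'.Γ_diff hy
  have key : ∀ u v w, fderiv ℝ φ y (fderiv ℝ Γ' y u v w)
      = fderiv ℝ (fderiv ℝ (fderiv ℝ φ)) y u v w
        + fderiv ℝ Γ (φ y) (fderiv ℝ φ y u) (fderiv ℝ φ y v) (fderiv ℝ φ y w)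
        + Γ (φ y) (fderiv ℝ (fderiv ℝ φ) y u v) (fderiv ℝ φ y w)
        + Γ (φ y) (fderiv ℝ φ y v) (fderiv ℝ (fderiv ℝ φ) y u w)
        - fderiv ℝ (fderiv ℝ φ) y u (Γ' y v w) := by
    intro u v w
    have e2 : (fun y => fderiv ℝ φ y (Γ' y v w)) =ᶠ[nhds y] fun y =>
        fderiv ℝ (fderiv ℝ φ) y v w + (Γ (φ y)) (fderiv ℝ φ y v) (fderiv ℝ φ y w) := by
      filter_upwards [h'.isOpen.mem_nhds hy] with y hy using ht hy v w
    have hΓφ : HasFDerivAt (fun y => Γ (φ y)) ((fderiv ℝ Γ (φ y)).comp (fderiv ℝ φ y)) y :=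
      hΓd.hasFDerivAt.comp y hφd.hasFDerivAt
    have hc : DifferentiableAt ℝ (fun y => Γ' y v w) y :=
      (hΓ'd.clm_apply (differentiableAt_const v)).clm_apply (differentiableAt_const w)
    have hJv : ∀ v, DifferentiableAt ℝ (fun y => fderiv ℝ φ y v) y := fun v =>
      hdφ.clm_apply (differentiableAt_const v)
    have e3 := congrArg (fun L : E →L[ℝ] E => L u) e2.fderiv_eq
    rw [(hdφ.hasFDerivAt.clm_apply hc.hasFDerivAt).fderiv, fderiv_fun_add
      ((hddφ.clm_apply (differentiableAt_const v)).clm_apply (differentiableAt_const w))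
      ((hΓφ.differentiableAt.clm_apply (hJv v)).clm_apply (hJv w))] at e3
    simp only [add_apply, ContinuousLinearMap.comp_apply, ContinuousLinearMap.flip_apply,
      fderiv_clm_apply_const hΓ'd] at e3
    rw [fderiv_clm_apply_apply (c := fun y => Γ (φ y)) hΓφ.differentiableAt (hJv v) (hJv w),
      hΓφ.fderiv, fderiv_clm_apply_const hddφ, fderiv_clm_apply_const_one hdφ,
      fderiv_clm_apply_const_one hdφ] at e3
    simp only [ContinuousLinearMap.comp_apply] at e3
    rw [eq_sub_iff_add_eq, e3]
    abel
  have h3 : fderiv ℝ (fderiv ℝ (fderiv ℝ φ)) y u v = fderiv ℝ (fderiv ℝ (fderiv ℝ φ)) y v u :=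
    fderiv_fderiv_symm h'.isOpen hdφ' hy u v
  have h2 : fderiv ℝ (fderiv ℝ φ) y u v = fderiv ℝ (fderiv ℝ φ) y v u :=
    fderiv_fderiv_symm h'.isOpen hφ hy u v
  simp only [curvOp, map_add, map_sub, key, ht hy]
  rw [h3, h2]
  abel

end Transformation

section Schur

variable {g : E → E →L[ℝ] E →L[ℝ] ℝ} {Γ : E → E →L[ℝ] E →L[ℝ] E} {U : Set E}

theorem exists_ne_zero_apply_eq_zero [FiniteDimensional ℝ E] (hE : 3 ≤ Module.finrank ℝ E)
    (f f' : E →L[ℝ] ℝ) : ∃ v, v ≠ 0 ∧ f v = 0 ∧ f' v = 0 := by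
  have := LinearMap.ker_ne_bot_of_finrank_lt (K := ℝ)
    (f := LinearMap.prod f.toLinearMap f'.toLinearMap) (by simp; omega)
  obtain ⟨v, hv, hv0⟩ := (Submodule.ne_bot_iff _).1 this
  refine ⟨v, hv0, ?_⟩
  simpa [LinearMap.prod_apply] using hv

/-- Schur's lemma: if the sectional curvature depends only on the point, it is locally constant. -/
theorem IsLeviCivita.schur [FiniteDimensional ℝ E] (hE : 3 ≤ Module.finrank ℝ E)
    (h : IsLeviCivita g Γ U) {κ : E → ℝ}
    (hκ : ∀ y ∈ U, ∀ u v z, curvOp Γ y u v z = κ y • (g y v z • u - g y u z • v))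
    {y : E} (hy : y ∈ U) : HasFDerivAt κ (0 : E →L[ℝ] ℝ) y := by
  have hgd := h.g_diff hy
  have hgc : ∀ v w : E, DifferentiableAt ℝ (fun y => g y v w) y := fun v w =>
    (hgd.clm_apply (differentiableAt_const v)).clm_apply (differentiableAt_const w)
  have hU := h.isOpen.mem_nhds hy
  -- Differentiability of `κ` is not assumed. Near `y` it is the quotient of `g(u, R(u,v)v)` by the
  -- Gram determinant of `u, v`, nonzero at `y` for nonzero orthogonal vectors.
  have hκd : DifferentiableAt ℝ κ y := by
    obtain ⟨u, hu, -, -⟩ := exists_ne_zero_apply_eq_zero hE (0 : E →L[ℝ] ℝ) 0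
    obtain ⟨v, hv, huv, -⟩ := exists_ne_zero_apply_eq_zero hE (g y u) 0
    set D : E → ℝ := fun y => g y v v * g y u u - g y u v * g y v u with hD
    have hDd : DifferentiableAt ℝ D y :=
      ((hgc v v).mul (hgc u u)).sub ((hgc u v).mul (hgc v u))
    have hD0 : D y ≠ 0 := by
      simp only [hD, huv, zero_mul, sub_zero]
      exact (mul_pos (h.g_pos y hy v hv) (h.g_pos y hy u hu)).ne'
    have hΓ : ∀ a b : E, DifferentiableAt ℝ (fun y => Γ y a b) y := fun a b =>
      ((h.Γ_diff hy).clm_apply (differentiableAt_const a)).clm_apply (differentiableAt_const b)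
    have hd : ∀ a b c : E, DifferentiableAt ℝ (fun y => fderiv ℝ Γ y a b c) y := fun a b c =>
      (((h.dΓ_diff hy).clm_apply (differentiableAt_const a)).clm_apply
        (differentiableAt_const b)).clm_apply (differentiableAt_const c)
    have hΓΓ : ∀ a b c : E, DifferentiableAt ℝ (fun y => Γ y a (Γ y b c)) y := fun a b c =>
      ((h.Γ_diff hy).clm_apply (differentiableAt_const a)).clm_apply (hΓ b c)
    have hR : DifferentiableAt ℝ (fun y => curvOp Γ y u v v) y :=
      (((hd u v v).fun_sub (hd v u v)).fun_add (hΓΓ u v v)).fun_sub (hΓΓ v u v)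
    have hN : DifferentiableAt ℝ (fun y => g y u (curvOp Γ y u v v)) y :=
      (hgd.clm_apply (differentiableAt_const u)).clm_apply hR
    refine (hN.mul (hDd.inv hD0)).congr_of_eventuallyEq ?_
    filter_upwards [hU, hDd.continuousAt.eventually_ne hD0] with x hx hDx
    simp only [Pi.mul_apply, Pi.inv_apply]
    rw [← div_eq_mul_inv, eq_div_iff hDx, hκ x hx]
    simp only [hD, map_smul, map_sub, smul_eq_mul]
    rw [h.g_symm x hx v u]
  have hfd : ∀ u v w z, fderiv ℝ (fun y => curvOp Γ y v w z) y u
      = fderiv ℝ κ y u • (g y w z • v - g y v z • w)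
        + κ y • ((g y (Γ y u w) z + g y w (Γ y u z)) • v
          - (g y (Γ y u v) z + g y v (Γ y u z)) • w) := by
    intro u v w z
    have e : (fun y => curvOp Γ y v w z)
        =ᶠ[nhds y] fun y => κ y • (g y w z • v - g y v z • w) := by
      filter_upwards [hU] with x hx using hκ x hx v w z
    have hs : DifferentiableAt ℝ (fun y => g y w z • v - g y v z • w) y :=
      ((hgc w z).smul_const v).fun_sub ((hgc v z).smul_const w)
    rw [e.fderiv_eq, fderiv_fun_smul hκd hs, fderiv_fun_sub ((hgc w z).smul_const v)
      ((hgc v z).smul_const w), fderiv_smul_const (hgc w z), fderiv_smul_const (hgc v z)]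
    simp only [add_apply, sub_apply, smul_apply, ContinuousLinearMap.smulRight_apply,
      fderiv_clm_apply_const hgd, h.compat y hy]
    abel
  -- Compatibility makes the metric parallel, so the second Bianchi identity retains only the
  -- derivatives of `κ`.
  have hcyc : ∀ u v w z, fderiv ℝ κ y u • (g y w z • v - g y v z • w)
      + fderiv ℝ κ y v • (g y u z • w - g y w z • u)
      + fderiv ℝ κ y w • (g y v z • u - g y u z • v) = 0 := by
    intro u v w z
    have e := h.curvOp_bianchi_second hy u v w z
    rw [hfd, hfd, hfd] at e
    simp only [hκ y hy, map_smul, map_sub] at e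
    rw [h.Γ_symm y hy v u, h.Γ_symm y hy w u, h.Γ_symm y hy w v] at e
    rw [← e]
    module
  have hz : fderiv ℝ κ y = 0 := by
    ext u
    obtain ⟨v, hv, huv, -⟩ := exists_ne_zero_apply_eq_zero hE (g y u) 0
    obtain ⟨w, hw, huw, hvw⟩ := exists_ne_zero_apply_eq_zero hE (g y u) (g y v)
    -- With `u, v, w` mutually orthogonal and `z = w`, pairing with `v` leaves `dκ(u) g(w,w) g(v,v)
    -- = 0`; this is where dimension at least 3 enters.
    have e := congrArg (g y v) (hcyc u v w w)
    rw [huw, hvw] at e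
    have hvu : g y v u = 0 := by rw [h.g_symm y hy, huv]
    simp only [map_add, map_sub, map_smul, hvw, hvu, smul_eq_mul, map_zero] at e
    have h1 := (h.g_pos y hy v hv).ne'
    have h2 := (h.g_pos y hy w hw).ne'
    have : fderiv ℝ κ y u * (g y w w * g y v v) = 0 := by linear_combination e
    simpa [h1, h2] using this
  rw [← hz]
  exact hκd.hasFDerivAt

end Schur

end LocalGeometry

/-! ### Agreement of the index formulas with the local theory. -/

section CoordinateMetric

set_option maxSynthPendingDepth 3
set_option synthInstance.maxHeartbeats 200000

variable {n : ℕ}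

theorem isLinearMap_eq_sum {f : EuclideanSpace ℝ (Fin n) → ℝ} (hf : IsLinearMap ℝ f)
    (u : EuclideanSpace ℝ (Fin n)) : f u = ∑ i, u i * f (EuclideanSpace.single i 1) := by
  have hu := (EuclideanSpace.basisFun (Fin n) ℝ).sum_repr u
  have := congrArg (hf.mk' f) hu
  rw [map_sum] at this
  simp only [map_smul, EuclideanSpace.basisFun_repr, EuclideanSpace.basisFun_apply,
    IsLinearMap.mk'_apply, smul_eq_mul] at this
  exact this.symm

theorem IsQuadrilinear.eq_sum {Ω : EuclideanSpace ℝ (Fin n) → EuclideanSpace ℝ (Fin n) →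
    EuclideanSpace ℝ (Fin n) → EuclideanSpace ℝ (Fin n) → ℝ} (q : IsQuadrilinear Ω)
    (u v w z : EuclideanSpace ℝ (Fin n)) :
    Ω u v w z = ∑ i, ∑ j, ∑ k, ∑ l, u i * v j * w k * z l *
      Ω (EuclideanSpace.single i 1) (EuclideanSpace.single j 1) (EuclideanSpace.single k 1)
        (EuclideanSpace.single l 1) := by
  rw [isLinearMap_eq_sum (q.fst v w z)]
  refine Finset.sum_congr rfl fun i _ => ?_
  rw [isLinearMap_eq_sum (q.snd _ w z), Finset.mul_sum]
  refine Finset.sum_congr rfl fun j _ => ?_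
  rw [isLinearMap_eq_sum (q.trd _ _ z), Finset.mul_sum, Finset.mul_sum]
  refine Finset.sum_congr rfl fun k _ => ?_
  rw [isLinearMap_eq_sum (q.fth _ _ _), Finset.mul_sum, Finset.mul_sum, Finset.mul_sum]
  refine Finset.sum_congr rfl fun l _ => ?_
  ring

/-- The `i`-th coordinate as a continuous linear form. -/
def coordProj (i : Fin n) : EuclideanSpace ℝ (Fin n) →L[ℝ] ℝ := EuclideanSpace.proj i

@[simp]
theorem coordProj_apply (i : Fin n) (u : EuclideanSpace ℝ (Fin n)) : coordProj i u = u i := rfl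

/-- The bilinear form with coefficient matrix `G y`. -/
def metricMap (G : EuclideanSpace ℝ (Fin n) → Matrix (Fin n) (Fin n) ℝ)
    (y : EuclideanSpace ℝ (Fin n)) :
    EuclideanSpace ℝ (Fin n) →L[ℝ] EuclideanSpace ℝ (Fin n) →L[ℝ] ℝ :=
  ∑ i, ∑ j, G y i j • (coordProj i).smulRight
    (coordProj j)

/-- The bilinear map with the Christoffel symbols of `G` as coefficients. -/
def christoffelMap (G : EuclideanSpace ℝ (Fin n) → Matrix (Fin n) (Fin n) ℝ)
    (y : EuclideanSpace ℝ (Fin n)) :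
    EuclideanSpace ℝ (Fin n) →L[ℝ] EuclideanSpace ℝ (Fin n) →L[ℝ] EuclideanSpace ℝ (Fin n) :=
  ∑ k, ∑ i, ∑ j, christoffel G k i j y •
    (coordProj i).smulRight
      ((coordProj j).smulRight
        (EuclideanSpace.single k (1 : ℝ)))

variable (G : EuclideanSpace ℝ (Fin n) → Matrix (Fin n) (Fin n) ℝ)

theorem metricMap_apply (y u v : EuclideanSpace ℝ (Fin n)) :
    metricMap G y u v = ∑ i, ∑ j, G y i j * (u i * v j) := by
  simp [metricMap, sum_apply]

theorem christoffelMap_apply_apply (y u v : EuclideanSpace ℝ (Fin n)) (k : Fin n) :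
    christoffelMap G y u v k = ∑ i, ∑ j, christoffel G k i j y * (u i * v j) := by
  simp [christoffelMap, sum_apply, Finset.sum_apply, Pi.single_apply]

theorem metricMap_single_single (y : EuclideanSpace ℝ (Fin n)) (a b : Fin n) :
    metricMap G y (EuclideanSpace.single a 1) (EuclideanSpace.single b 1) = G y a b := by
  simp [metricMap_apply]

theorem metricMap_apply_single (y u : EuclideanSpace ℝ (Fin n)) (b : Fin n) :
    metricMap G y u (EuclideanSpace.single b 1) = ∑ k, G y k b * u k := by
  simp [metricMap_apply]

theorem metricMap_single_apply (y u : EuclideanSpace ℝ (Fin n)) (b : Fin n) :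
    metricMap G y (EuclideanSpace.single b 1) u = ∑ k, G y b k * u k := by
  simp [metricMap_apply]

theorem christoffelMap_single_single (y : EuclideanSpace ℝ (Fin n)) (a b k : Fin n) :
    christoffelMap G y (EuclideanSpace.single a 1) (EuclideanSpace.single b 1) k
      = christoffel G k a b y := by
  simp [christoffelMap_apply_apply]

theorem christoffelMap_single_apply (y u : EuclideanSpace ℝ (Fin n)) (a k : Fin n) :
    christoffelMap G y (EuclideanSpace.single a 1) u k
      = ∑ b, christoffel G k a b y * u b := by
  simp [christoffelMap_apply_apply]

/-- The coefficients of `G` are smooth on the open set `U` and define a Riemannian metric there. -/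
structure IsMetricOn (U : Set (EuclideanSpace ℝ (Fin n))) : Prop where
  isOpen : IsOpen U
  smooth : ∀ i j, ContDiffOn ℝ ∞ (fun y => G y i j) U
  symm : ∀ y ∈ U, ∀ i j, G y i j = G y j i
  pos : ∀ y ∈ U, ∀ u, u ≠ 0 → 0 < metricMap G y u u

/-- The curvature tensor `R(u ∧ v, w ∧ z)` of the metric with coefficients `G`. -/
def coordCurvature (y u v w z : EuclideanSpace ℝ (Fin n)) : ℝ :=
  metricMap G y w (curvOp (christoffelMap G) y u v z)

theorem contDiffOn_det {U : Set (EuclideanSpace ℝ (Fin n))}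
    {A : EuclideanSpace ℝ (Fin n) → Matrix (Fin n) (Fin n) ℝ}
    (hA : ∀ i j, ContDiffOn ℝ ∞ (fun y => A y i j) U) : ContDiffOn ℝ ∞ (fun y => (A y).det) U := by
  simp only [Matrix.det_apply]
  exact ContDiffOn.sum fun σ _ => (contDiffOn_prod fun i _ => hA _ _).const_smul _

namespace IsMetricOn

variable {G} {U : Set (EuclideanSpace ℝ (Fin n))} (h : IsMetricOn G U)
include h

theorem det_ne_zero {y : EuclideanSpace ℝ (Fin n)} (hy : y ∈ U) : (G y).det ≠ 0 := by
  intro h0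
  obtain ⟨v, hv, hv0⟩ := Matrix.exists_mulVec_eq_zero_iff.2 h0
  have := h.pos y hy (WithLp.toLp 2 v) (by simpa using hv)
  rw [metricMap_apply] at this
  have e : ∀ i, ∑ j, G y i j * (v i * v j) = 0 := fun i => by
    have := congrFun hv0 i
    simp only [Matrix.mulVec, dotProduct, Pi.zero_apply] at this
    have h2 : ∑ j, G y i j * (v i * v j) = v i * ∑ j, G y i j * v j := by
      rw [Finset.mul_sum]
      exact Finset.sum_congr rfl fun j _ => by ring
    rw [h2, this, mul_zero]
  simp only [e, Finset.sum_const_zero, lt_irrefl] at this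

theorem contDiffOn_inv (i j : Fin n) : ContDiffOn ℝ ∞ (fun y => (G y)⁻¹ i j) U := by
  have : (fun y => (G y)⁻¹ i j) = fun y => ((G y).det)⁻¹ * (G y).adjugate i j := by
    funext y
    rw [Matrix.inv_def, Ring.inverse_eq_inv', Matrix.smul_apply, smul_eq_mul]
  rw [this]
  refine ((contDiffOn_det h.smooth).inv fun y hy => h.det_ne_zero hy).mul ?_
  simp only [Matrix.adjugate_apply]
  refine contDiffOn_det fun k l => ?_
  by_cases hk : k = j
  · subst hk
    simpa using contDiffOn_const
  · simpa [Matrix.updateRow_ne hk] using h.smooth k l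

theorem contDiffOn_partialDeriv {f : EuclideanSpace ℝ (Fin n) → ℝ} (hf : ContDiffOn ℝ ∞ f U)
    (i : Fin n) : ContDiffOn ℝ ∞ (partialDeriv i f) U :=
  (contDiffOn_fderiv h.isOpen hf).clm_apply contDiffOn_const

theorem contDiffOn_christoffel (k i j : Fin n) : ContDiffOn ℝ ∞ (christoffel G k i j) U := by
  unfold christoffel
  refine contDiffOn_const.mul (ContDiffOn.sum fun l _ => (h.contDiffOn_inv k l).mul ?_)
  exact ((h.contDiffOn_partialDeriv (h.smooth _ _) _).add
    (h.contDiffOn_partialDeriv (h.smooth _ _) _)).sub (h.contDiffOn_partialDeriv (h.smooth _ _) _)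

theorem contDiffOn_metricMap : ContDiffOn ℝ ∞ (metricMap G) U := by
  unfold metricMap
  exact ContDiffOn.sum fun i _ => ContDiffOn.sum fun j _ => (h.smooth i j).smul contDiffOn_const

theorem contDiffOn_christoffelMap : ContDiffOn ℝ ∞ (christoffelMap G) U := by
  unfold christoffelMap
  exact ContDiffOn.sum fun k _ => ContDiffOn.sum fun i _ => ContDiffOn.sum fun j _ =>
    (h.contDiffOn_christoffel k i j).smul contDiffOn_const

theorem partialDeriv_symm {y : EuclideanSpace ℝ (Fin n)} (hy : y ∈ U) (a i j : Fin n) :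
    partialDeriv a (fun y => G y i j) y = partialDeriv a (fun y => G y j i) y := by
  have : (fun y => G y i j) =ᶠ[nhds y] fun y => G y j i := by
    filter_upwards [h.isOpen.mem_nhds hy] with y hy using h.symm y hy i j
  rw [partialDeriv, partialDeriv, this.fderiv_eq]

theorem christoffel_symm {y : EuclideanSpace ℝ (Fin n)} (hy : y ∈ U) (k i j : Fin n) :
    christoffel G k i j y = christoffel G k j i y := by
  rw [christoffel, christoffel]
  congr 1
  refine Finset.sum_congr rfl fun l _ => ?_
  rw [h.partialDeriv_symm hy l i j]
  ring

/-- Lowering the index cancels the inverse matrix and leaves the Christoffel symbols of the first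
kind. -/
theorem sum_mul_christoffel {y : EuclideanSpace ℝ (Fin n)} (hy : y ∈ U) (c a b : Fin n) :
    ∑ k, G y c k * christoffel G k a b y
      = (1 / 2) * (partialDeriv a (fun y => G y b c) y + partialDeriv b (fun y => G y a c) y
        - partialDeriv c (fun y => G y a b) y) := by
  set B : Fin n → ℝ := fun l => partialDeriv a (fun y => G y b l) y
    + partialDeriv b (fun y => G y a l) y - partialDeriv l (fun y => G y a b) y with hB
  have hinv : G y * (G y)⁻¹ = 1 :=
    Matrix.mul_nonsing_inv _ (isUnit_iff_ne_zero.2 (h.det_ne_zero hy))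
  have e := congrFun (congrArg (fun A => Matrix.mulVec A B) hinv) c
  simp only [← Matrix.mulVec_mulVec, Matrix.one_mulVec] at e
  simp only [Matrix.mulVec, dotProduct] at e
  change _ = (1 / 2) * B c
  rw [← e, Finset.mul_sum]
  refine Finset.sum_congr rfl fun k _ => ?_
  rw [christoffel]
  ring

theorem isLeviCivita : IsLeviCivita (metricMap G) (christoffelMap G) U where
  isOpen := h.isOpen
  g_symm y hy u v := by
    rw [metricMap_apply, metricMap_apply, Finset.sum_comm]
    refine Finset.sum_congr rfl fun i _ => Finset.sum_congr rfl fun j _ => ?_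
    rw [h.symm y hy, mul_comm (u j)]
  g_pos := h.pos
  g_smooth := h.contDiffOn_metricMap
  Γ_smooth := h.contDiffOn_christoffelMap
  Γ_symm y hy u v := by
    ext k
    rw [christoffelMap_apply_apply, christoffelMap_apply_apply, Finset.sum_comm]
    refine Finset.sum_congr rfl fun i _ => Finset.sum_congr rfl fun j _ => ?_
    rw [h.christoffel_symm hy, mul_comm (u j)]
  compat y hy u v w := by
    have hd : DifferentiableAt ℝ (metricMap G) y :=
      ContDiffOn.differentiableAt_of_mem h.contDiffOn_metricMap h.isOpen hy
    -- The defect of compatibility is trilinear, so coordinate vectors suffice; there, two symbols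
    -- of the first kind add up to `∂_a G_bc`.
    set Ω : EuclideanSpace ℝ (Fin n) → EuclideanSpace ℝ (Fin n) → EuclideanSpace ℝ (Fin n) → ℝ :=
      fun u v w => fderiv ℝ (metricMap G) y u v w - (metricMap G y (christoffelMap G y u v) w
        + metricMap G y v (christoffelMap G y u w)) with hΩ
    have h1 : ∀ v w, IsLinearMap ℝ fun u => Ω u v w := fun v w => by
      constructor <;> intros <;>
        simp only [hΩ, map_add, map_smul, add_apply, smul_apply, smul_eq_mul] <;> ring
    have h2 : ∀ u w, IsLinearMap ℝ fun v => Ω u v w := fun u w => by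
      constructor <;> intros <;>
        simp only [hΩ, map_add, map_smul, add_apply, smul_apply, smul_eq_mul] <;> ring
    have h3 : ∀ u v, IsLinearMap ℝ fun w => Ω u v w := fun u v => by
      constructor <;> intros <;> simp only [hΩ, map_add, map_smul, smul_eq_mul] <;>
        ring
    have h0 : ∀ a b c, Ω (EuclideanSpace.single a 1) (EuclideanSpace.single b 1)
        (EuclideanSpace.single c 1) = 0 := fun a b c => by
      have e1 : fderiv ℝ (metricMap G) y (EuclideanSpace.single a 1) (EuclideanSpace.single b 1)
          (EuclideanSpace.single c 1) = partialDeriv a (fun y => G y b c) y := by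
        rw [← fderiv_clm_apply_const hd, partialDeriv]
        simp only [metricMap_single_single]
      have e2 : ∑ k, G y k c * christoffel G k a b y = ∑ k, G y c k * christoffel G k a b y :=
        Finset.sum_congr rfl fun k _ => by rw [h.symm y hy]
      simp only [hΩ]
      rw [e1, metricMap_apply_single, metricMap_single_apply]
      simp only [christoffelMap_single_single]
      rw [e2, h.sum_mul_christoffel hy, h.sum_mul_christoffel hy]
      linarith [h.partialDeriv_symm hy a c b, h.partialDeriv_symm hy c a b,
        h.partialDeriv_symm hy b a c]
    refine sub_eq_zero.1 (?_ : Ω u v w = 0)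
    rw [isLinearMap_eq_sum (h1 v w)]
    refine Finset.sum_eq_zero fun a _ => ?_
    rw [isLinearMap_eq_sum (h2 _ w), Finset.sum_eq_zero, mul_zero]
    intro b _
    rw [isLinearMap_eq_sum (h3 _ _), Finset.sum_eq_zero, mul_zero]
    intro c _
    rw [h0, mul_zero]

theorem curvOp_single_apply {y : EuclideanSpace ℝ (Fin n)} (hy : y ∈ U) (i j l m : Fin n) :
    curvOp (christoffelMap G) y (EuclideanSpace.single i 1) (EuclideanSpace.single j 1)
      (EuclideanSpace.single l 1) m = riemannUp G m l i j y := by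
  have hd : DifferentiableAt ℝ (christoffelMap G) y :=
    ContDiffOn.differentiableAt_of_mem h.contDiffOn_christoffelMap h.isOpen hy
  have e : ∀ i j, (fderiv ℝ (christoffelMap G) y (EuclideanSpace.single i 1)
      (EuclideanSpace.single j 1) (EuclideanSpace.single l 1)) m
      = partialDeriv i (christoffel G m j l) y := fun i j => by
    have hc : DifferentiableAt ℝ (fun y => christoffelMap G y (EuclideanSpace.single j 1)
        (EuclideanSpace.single l 1)) y :=
      (hd.clm_apply (differentiableAt_const _)).clm_apply (differentiableAt_const _)
    have := ((coordProj m).hasFDerivAt.comp y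
      hc.hasFDerivAt).fderiv
    rw [← fderiv_clm_apply_const hd, partialDeriv]
    have e2 : christoffel G m j l = (coordProj m) ∘
        fun y => christoffelMap G y (EuclideanSpace.single j 1) (EuclideanSpace.single l 1) := by
      funext y
      exact (christoffelMap_single_single G y j l m).symm
    rw [e2, this]
    rfl
  have e' : ∀ i j, christoffelMap G y (EuclideanSpace.single i 1)
      (christoffelMap G y (EuclideanSpace.single j 1) (EuclideanSpace.single l 1)) m
      = ∑ a, christoffel G m i a y * christoffel G a j l y := fun i j => by
    rw [christoffelMap_single_apply]
    simp only [christoffelMap_single_single]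
  simp only [curvOp, riemannUp, PiLp.add_apply, PiLp.sub_apply, e, e', Finset.sum_sub_distrib]
  ring

theorem isCurvatureLike_coordCurvature {y : EuclideanSpace ℝ (Fin n)} (hy : y ∈ U) :
    IsCurvatureLike (coordCurvature G y) where
  linear v w z := by
    constructor
    · intro a b
      simp only [coordCurvature, curvOp_add, map_add]
    · intro c a
      simp only [coordCurvature, curvOp_smul, map_smul]
  swap u v w z := by simp only [coordCurvature, curvOp_swap _ y u v, map_neg]
  pair := h.isLeviCivita.curvature_pair hy
  bianchi := h.isLeviCivita.curvature_bianchi hy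

theorem coordCurvature_eq_sum {y : EuclideanSpace ℝ (Fin n)} (hy : y ∈ U)
    (u v w z : EuclideanSpace ℝ (Fin n)) :
    coordCurvature G y u v w z
      = ∑ i, ∑ j, ∑ k, ∑ l, u i * v j * w k * z l * riemannDown G i j k l y := by
  rw [(h.isCurvatureLike_coordCurvature hy).isQuadrilinear.eq_sum]
  refine Finset.sum_congr rfl fun i _ => Finset.sum_congr rfl fun j _ => Finset.sum_congr rfl
    fun k _ => Finset.sum_congr rfl fun l _ => ?_
  rw [coordCurvature, metricMap_single_apply, riemannDown]
  simp only [h.curvOp_single_apply hy]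

end IsMetricOn

end CoordinateMetric

/-! ### Charts of the manifold and globalization. -/

section Charts

set_option maxSynthPendingDepth 3
set_option synthInstance.maxHeartbeats 200000

variable (n : ℕ) {M : Type*} [TopologicalSpace M] [ChartedSpace (EuclideanSpace ℝ (Fin n)) M]

/-- The derivative at `y` of the inverse of the preferred chart at `x`, the tangent spaces of `M`
being identified with the model space. -/
def chartDeriv (x : M) (y : EuclideanSpace ℝ (Fin n)) :
    EuclideanSpace ℝ (Fin n) →L[ℝ] EuclideanSpace ℝ (Fin n) :=
  mfderiv 𝓘(ℝ, EuclideanSpace ℝ (Fin n)) (𝓡 n) (extChartAt (𝓡 n) x).symm y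

/-- The change of coordinates from the preferred chart at `x` to that at `x₀`. -/
def chartChange (x₀ x : M) : EuclideanSpace ℝ (Fin n) → EuclideanSpace ℝ (Fin n) :=
  extChartAt (𝓡 n) x₀ ∘ (extChartAt (𝓡 n) x).symm

/-- The domain of `chartChange`. -/
def chartOverlap (x₀ x : M) : Set (EuclideanSpace ℝ (Fin n)) :=
  (extChartAt (𝓡 n) x).target ∩ (extChartAt (𝓡 n) x).symm ⁻¹' (extChartAt (𝓡 n) x₀).source

theorem isOpen_chartOverlap (x₀ x : M) : IsOpen (chartOverlap n x₀ x) :=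
  (continuousOn_extChartAt_symm x).isOpen_inter_preimage (isOpen_extChartAt_target x)
    (isOpen_extChartAt_source x₀)

theorem mapsTo_chartChange (x₀ x : M) :
    Set.MapsTo (chartChange n x₀ x) (chartOverlap n x₀ x) (extChartAt (𝓡 n) x₀).target :=
  fun _ hy => (extChartAt (𝓡 n) x₀).map_source hy.2

theorem extChartAt_symm_chartChange (x₀ x : M) {y : EuclideanSpace ℝ (Fin n)}
    (hy : y ∈ chartOverlap n x₀ x) :
    (extChartAt (𝓡 n) x₀).symm (chartChange n x₀ x y) = (extChartAt (𝓡 n) x).symm y :=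
  (extChartAt (𝓡 n) x₀).left_inv hy.2

section Smooth

variable [IsManifold (𝓡 n) ∞ M]

/-- Gives smoothness of the metric coefficients: the field is the tangent map of the inverse chart
applied to a constant field. -/
theorem contMDiffOn_chartVec (x : M) (u : EuclideanSpace ℝ (Fin n)) :
    ContMDiffOn 𝓘(ℝ, EuclideanSpace ℝ (Fin n)) ((𝓡 n).prod 𝓘(ℝ, EuclideanSpace ℝ (Fin n))) ∞
      (fun y => (⟨(extChartAt (𝓡 n) x).symm y, chartDeriv n x y u⟩ : TangentBundle (𝓡 n) M))
      (extChartAt (𝓡 n) x).target := by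
  have ho : IsOpen (extChartAt (𝓡 n) x).target := isOpen_extChartAt_target x
  have h1 := (contMDiffOn_extChartAt_symm (I := 𝓡 n) (n := ∞) x).contMDiffOn_tangentMapWithin
    (m := ∞) (by simp) ho.uniqueMDiffOn
  have h2 : ContMDiffOn 𝓘(ℝ, EuclideanSpace ℝ (Fin n))
      (𝓘(ℝ, EuclideanSpace ℝ (Fin n)).prod 𝓘(ℝ, EuclideanSpace ℝ (Fin n))) ∞
      (fun y => (⟨y, u⟩ : TangentBundle 𝓘(ℝ, EuclideanSpace ℝ (Fin n)) (EuclideanSpace ℝ (Fin n))))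
      (extChartAt (𝓡 n) x).target :=
    contMDiffOn_vectorSpace_iff_contDiffOn.2 contDiffOn_const
  refine (h1.comp h2 fun y hy => hy).congr fun y hy => ?_
  simp only [Function.comp, tangentMapWithin, chartDeriv]
  rw [mfderivWithin_of_isOpen ho hy]
  rfl

theorem bijective_chartDeriv (x : M) {y : EuclideanSpace ℝ (Fin n)}
    (hy : y ∈ (extChartAt (𝓡 n) x).target) : Function.Bijective (chartDeriv n x y) := by
  have h := isInvertible_mfderivWithin_extChartAt_symm (I := 𝓡 n) hy
  simp only [modelWithCornersSelf_coe, Set.range_id, mfderivWithin_univ] at h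
  exact h.bijective

theorem chartDeriv_self (x : M) :
    chartDeriv n x (extChartAt (𝓡 n) x x) = ContinuousLinearMap.id ℝ _ := by
  have h := mfderivWithin_range_extChartAt_symm (I := 𝓡 n) (x := x)
  simp only [modelWithCornersSelf_coe, Set.range_id, mfderivWithin_univ] at h
  exact h

/-- The tangent space at `x` is identified with the model space through the preferred chart at `x`,
whose derivative there is the identity. -/
theorem tangentCoord_eq (x : M) (u : EuclideanSpace ℝ (Fin n)) (i : Fin n) :
    tangentCoord n x u i = u i := by
  have h := mfderiv_extChartAt_self (I := 𝓡 n) (x := x)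
  exact congrArg (fun T : EuclideanSpace ℝ (Fin n) →L[ℝ] EuclideanSpace ℝ (Fin n) => T u i) h

theorem contDiffOn_chartChange (x₀ x : M) :
    ContDiffOn ℝ ∞ (chartChange n x₀ x) (chartOverlap n x₀ x) := by
  rw [← contMDiffOn_iff_contDiffOn]
  refine (contMDiffOn_extChartAt (I := 𝓡 n) (n := ∞) (x := x₀)).comp
    ((contMDiffOn_extChartAt_symm (I := 𝓡 n) (n := ∞) x).mono Set.inter_subset_left) ?_
  intro y hy
  have := hy.2
  rwa [Set.mem_preimage, extChartAt_source] at this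

theorem chartDeriv_comp_fderiv (x₀ x : M) {y : EuclideanSpace ℝ (Fin n)}
    (hy : y ∈ chartOverlap n x₀ x) :
    chartDeriv n x y
      = (chartDeriv n x₀ (chartChange n x₀ x y)).comp (fderiv ℝ (chartChange n x₀ x) y) := by
  have ho := isOpen_chartOverlap n x₀ x
  have e : (extChartAt (𝓡 n) x).symm =ᶠ[nhds y]
      (extChartAt (𝓡 n) x₀).symm ∘ chartChange n x₀ x := by
    filter_upwards [ho.mem_nhds hy] with z hz
    exact (extChartAt_symm_chartChange n x₀ x hz).symm
  have d1 : MDifferentiableAt 𝓘(ℝ, EuclideanSpace ℝ (Fin n)) (𝓡 n) (extChartAt (𝓡 n) x₀).symm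
      (chartChange n x₀ x y) := by
    have := mdifferentiableWithinAt_extChartAt_symm (I := 𝓡 n) (mapsTo_chartChange n x₀ x hy)
    simpa only [modelWithCornersSelf_coe, Set.range_id, mdifferentiableWithinAt_univ] using this
  have d2 : DifferentiableAt ℝ (chartChange n x₀ x) y :=
    ContDiffOn.differentiableAt_of_mem (contDiffOn_chartChange n x₀ x) ho hy
  have := mfderiv_comp y d1 d2.mdifferentiableAt
  rw [mfderiv_eq_fderiv] at this
  rw [chartDeriv, e.mfderiv_eq]
  exact this

theorem surjective_fderiv_chartChange (x₀ x : M) {y : EuclideanSpace ℝ (Fin n)}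
    (hy : y ∈ chartOverlap n x₀ x) : Function.Surjective (fderiv ℝ (chartChange n x₀ x) y) := by
  have h := (bijective_chartDeriv n x hy.1).1
  rw [chartDeriv_comp_fderiv n x₀ x hy, ContinuousLinearMap.coe_comp] at h
  exact (LinearMap.injective_iff_surjective
    (f := (fderiv ℝ (chartChange n x₀ x) y : EuclideanSpace ℝ (Fin n) →ₗ[ℝ] _))).1
    (Function.Injective.of_comp h)

end Smooth

variable [RiemannianBundle (fun x : M => TangentSpace (𝓡 n) x)]

/-- The metric at `x`, the tangent space being identified with the model space. -/
def fiberInner (x : M) (u v : EuclideanSpace ℝ (Fin n)) : ℝ :=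
  inner ℝ (show TangentSpace (𝓡 n) x from u) (show TangentSpace (𝓡 n) x from v)

theorem metricMap_coordMetric (x : M) (y u v : EuclideanSpace ℝ (Fin n)) :
    metricMap (coordMetric n x) y u v
      = fiberInner n ((extChartAt (𝓡 n) x).symm y) (chartDeriv n x y u) (chartDeriv n x y v) := by
  have h1 : ∀ v, IsLinearMap ℝ fun u => fiberInner n ((extChartAt (𝓡 n) x).symm y)
      (chartDeriv n x y u) (chartDeriv n x y v) := fun v => by
    constructor
    · intro a b
      rw [map_add]
      exact inner_add_left _ _ _
    · intro c a
      rw [map_smul]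
      exact real_inner_smul_left _ _ _
  have h2 : ∀ u, IsLinearMap ℝ fun v => fiberInner n ((extChartAt (𝓡 n) x).symm y)
      (chartDeriv n x y u) (chartDeriv n x y v) := fun u => by
    constructor
    · intro a b
      rw [map_add]
      exact inner_add_right _ _ _
    · intro c a
      rw [map_smul]
      exact real_inner_smul_right _ _ _
  rw [metricMap_apply, isLinearMap_eq_sum (h1 v)]
  refine Finset.sum_congr rfl fun i _ => ?_
  rw [isLinearMap_eq_sum (h2 _), Finset.mul_sum]
  refine Finset.sum_congr rfl fun j _ => ?_
  rw [mul_comm, mul_assoc]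
  rfl

variable [IsManifold (𝓡 n) ∞ M]

theorem fiberInner_eq_metricMap (x : M) (u v : EuclideanSpace ℝ (Fin n)) :
    fiberInner n x u v = metricMap (coordMetric n x) (extChartAt (𝓡 n) x x) u v := by
  rw [metricMap_coordMetric, chartDeriv_self, extChartAt_to_inv]
  rfl

/-- Both coefficient matrices represent the same metric on `M`; this is the isometry hypothesis of
`IsLeviCivita.curvOp_transform`. -/
theorem metricMap_chartChange (x₀ x : M) {y : EuclideanSpace ℝ (Fin n)}
    (hy : y ∈ chartOverlap n x₀ x) (u v : EuclideanSpace ℝ (Fin n)) :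
    metricMap (coordMetric n x) y u v = metricMap (coordMetric n x₀) (chartChange n x₀ x y)
      (fderiv ℝ (chartChange n x₀ x) y u) (fderiv ℝ (chartChange n x₀ x) y v) := by
  rw [metricMap_coordMetric, metricMap_coordMetric, extChartAt_symm_chartChange n x₀ x hy,
    chartDeriv_comp_fderiv n x₀ x hy]
  rfl

variable [IsContMDiffRiemannianBundle (𝓡 n) ∞ (EuclideanSpace ℝ (Fin n))
  (fun x : M => TangentSpace (𝓡 n) x)]

theorem isMetricOn_coordMetric (x : M) :
    IsMetricOn (coordMetric n x) (extChartAt (𝓡 n) x).target where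
  isOpen := isOpen_extChartAt_target x
  smooth i j := by
    rw [← contMDiffOn_iff_contDiffOn]
    exact ContMDiffOn.inner_bundle (contMDiffOn_chartVec n x (EuclideanSpace.single i 1))
      (contMDiffOn_chartVec n x (EuclideanSpace.single j 1))
  symm y _ i j := real_inner_comm (coordVec n x j y) (coordVec n x i y)
  pos y hy u hu := by
    rw [metricMap_coordMetric]
    refine real_inner_self_pos.2 fun h => hu ?_
    exact (bijective_chartDeriv n x hy).1 (h.trans (map_zero _).symm)

theorem curvature_eq_coordCurvature (x : M) (u v w z : EuclideanSpace ℝ (Fin n)) :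
    curvature n x u v w z = coordCurvature (coordMetric n x) (extChartAt (𝓡 n) x x) u v w z := by
  rw [(isMetricOn_coordMetric n x).coordCurvature_eq_sum (mem_extChartAt_target x)]
  refine Finset.sum_congr rfl fun i _ => Finset.sum_congr rfl fun j _ => Finset.sum_congr rfl
    fun k _ => Finset.sum_congr rfl fun l _ => ?_
  rw [tangentCoord_eq n x u, tangentCoord_eq n x v, tangentCoord_eq n x w, tangentCoord_eq n x z]

theorem isCurvatureLike_curvature (x : M) : IsCurvatureLike (curvature n x) := by
  have h := (isMetricOn_coordMetric n x).isCurvatureLike_coordCurvature (mem_extChartAt_target x)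
  have e : (curvature n x : EuclideanSpace ℝ (Fin n) → EuclideanSpace ℝ (Fin n) →
      EuclideanSpace ℝ (Fin n) → EuclideanSpace ℝ (Fin n) → ℝ)
      = coordCurvature (coordMetric n x) (extChartAt (𝓡 n) x x) := by
    funext u v w z
    exact curvature_eq_coordCurvature n x u v w z
  rw [← e] at h
  -- The predicate mentions the inner product space structure, Euclidean in `h` and Riemannian in
  -- the goal. The linear structure is the same, so the fields carry over.
  refine ⟨fun v w z => ⟨fun a b => ?_, fun c a => ?_⟩, h.swap, h.pair, h.bianchi⟩
  · exact (h.linear v w z).map_add a b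
  · exact (h.linear v w z).map_smul c a

theorem isLeviCivita_coordMetric (x : M) :
    IsLeviCivita (metricMap (coordMetric n x)) (christoffelMap (coordMetric n x))
      (extChartAt (𝓡 n) x).target :=
  (isMetricOn_coordMetric n x).isLeviCivita

variable {n}

/-- Polarization determines the curvature tensor, and nondegeneracy of the metric turns this into an
identity of operators, so far only at the center of the chart. -/
theorem curvOp_center {x : M} {κ : ℝ} (hκ : ∀ e : Fin 2 → TangentSpace (𝓡 n) x,
    Orthonormal ℝ e → curvature n x (e 0) (e 1) (e 0) (e 1) = κ)
    (u v z : EuclideanSpace ℝ (Fin n)) :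
    curvOp (christoffelMap (coordMetric n x)) (extChartAt (𝓡 n) x x) u v z
      = κ • (metricMap (coordMetric n x) (extChartAt (𝓡 n) x x) v z • u
        - metricMap (coordMetric n x) (extChartAt (𝓡 n) x x) u z • v) := by
  have hL := isLeviCivita_coordMetric n x
  have hx := mem_extChartAt_target (I := 𝓡 n) x
  set y := extChartAt (𝓡 n) x x with hy
  set g := metricMap (coordMetric n x) y with hg
  set a := curvOp (christoffelMap (coordMetric n x)) y u v z with ha
  set b := κ • (g v z • u - g u z • v) with hb
  have key : ∀ w, g w a = g w b := fun w => by
    have h1 := curvature_eq_coordCurvature n x u v w z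
    rw [(isCurvatureLike_curvature n x).eq_of_sectional_eq hκ u v w z] at h1
    have h2 := fiberInner_eq_metricMap n x
    have h3 : κ * (fiberInner n x u w * fiberInner n x v z
        - fiberInner n x u z * fiberInner n x v w) = g w a := h1
    rw [← h3, h2, h2, h2, h2]
    simp only [hb, map_smul, map_sub, smul_eq_mul]
    rw [hg, hL.g_symm y hx w u, hL.g_symm y hx w v]
    ring
  by_contra hab
  have h1 := hL.g_pos y hx (a - b) (sub_ne_zero.2 hab)
  rw [map_sub (metricMap (coordMetric n x) y (a - b)), ← hg, key, sub_self] at h1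
  exact lt_irrefl _ h1

/-- Schur's lemma differentiates within one chart, while the hypothesis at each point refers to that
point's own preferred chart. The transformation law carries the identity from the latter to the
former. -/
theorem curvOp_chart {κ : M → ℝ} (hκ : ∀ (x : M) (e : Fin 2 → TangentSpace (𝓡 n) x),
    Orthonormal ℝ e → curvature n x (e 0) (e 1) (e 0) (e 1) = κ x) (x₀ : M)
    {y : EuclideanSpace ℝ (Fin n)} (hy : y ∈ (extChartAt (𝓡 n) x₀).target)
    (u v z : EuclideanSpace ℝ (Fin n)) :
    curvOp (christoffelMap (coordMetric n x₀)) y u v z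
      = κ ((extChartAt (𝓡 n) x₀).symm y) • (metricMap (coordMetric n x₀) y v z • u
        - metricMap (coordMetric n x₀) y u z • v) := by
  obtain ⟨x, hx⟩ : ∃ x, x = (extChartAt (𝓡 n) x₀).symm y := ⟨_, rfl⟩
  rw [← hx]
  have hO : extChartAt (𝓡 n) x x ∈ chartOverlap n x₀ x := by
    refine ⟨mem_extChartAt_target x, ?_⟩
    rw [Set.mem_preimage, extChartAt_to_inv, hx]
    exact (extChartAt (𝓡 n) x₀).map_target hy
  have hφ : chartChange n x₀ x (extChartAt (𝓡 n) x x) = y := by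
    rw [chartChange, Function.comp_apply, extChartAt_to_inv, hx]
    exact (extChartAt (𝓡 n) x₀).right_inv hy
  have hs := surjective_fderiv_chartChange n x₀ x hO
  obtain ⟨u, rfl⟩ := hs u
  obtain ⟨v, rfl⟩ := hs v
  obtain ⟨z, rfl⟩ := hs z
  have h := (isLeviCivita_coordMetric n x₀).curvOp_transform
    ((isLeviCivita_coordMetric n x).mono (isOpen_chartOverlap n x₀ x) Set.inter_subset_left)
    (contDiffOn_chartChange n x₀ x) (mapsTo_chartChange n x₀ x)
    (fun y hy => metricMap_chartChange n x₀ x hy)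
    (fun y hy => surjective_fderiv_chartChange n x₀ x hy) hO u v z
  rw [curvOp_center (hκ x), metricMap_chartChange n x₀ x hO, metricMap_chartChange n x₀ x hO,
    hφ] at h
  rw [← h]
  simp only [map_smul, map_sub]

/-- By Schur's lemma `κ` has zero derivative in every chart, so its level sets are open. -/
theorem isLocallyConstant_sectional (hn : 3 ≤ n) {κ : M → ℝ}
    (hκ : ∀ (x : M) (e : Fin 2 → TangentSpace (𝓡 n) x),
      Orthonormal ℝ e → curvature n x (e 0) (e 1) (e 0) (e 1) = κ x) :
    IsLocallyConstant κ := by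
  rw [IsLocallyConstant.iff_eventually_eq]
  intro x
  set f : EuclideanSpace ℝ (Fin n) → ℝ := fun y => κ ((extChartAt (𝓡 n) x).symm y) with hf
  have hd : ∀ y ∈ (extChartAt (𝓡 n) x).target,
      HasFDerivAt f (0 : EuclideanSpace ℝ (Fin n) →L[ℝ] ℝ) y := fun y hy =>
    (isLeviCivita_coordMetric n x).schur (by simpa using hn)
      (fun y hy u v z => curvOp_chart hκ x hy u v z) hy
  have ho : IsOpen (extChartAt (𝓡 n) x).target := isOpen_extChartAt_target x
  have hc := ho.isOpen_inter_preimage_of_fderiv_eq_zero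
    (fun y hy => (hd y hy).differentiableAt.differentiableWithinAt) (fun y hy => (hd y hy).fderiv)
    {κ x}
  have hx : extChartAt (𝓡 n) x x ∈ (extChartAt (𝓡 n) x).target ∩ f ⁻¹' {κ x} := by
    refine ⟨mem_extChartAt_target x, ?_⟩
    rw [Set.mem_preimage, hf, Set.mem_singleton_iff]
    exact congrArg κ (extChartAt_to_inv x)
  filter_upwards [(continuousAt_extChartAt (I := 𝓡 n) x).preimage_mem_nhds (hc.mem_nhds hx),
    extChartAt_source_mem_nhds (I := 𝓡 n) x] with z hz hz'
  have h : κ ((extChartAt (𝓡 n) x).symm (extChartAt (𝓡 n) x z)) = κ x := hz.2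
  rwa [(extChartAt (𝓡 n) x).left_inv hz'] at h

theorem hasConstantSectionalCurvature_of_pointwise [PreconnectedSpace M] (hn : 3 ≤ n)
    (H : ∀ x : M, ∃ κ : ℝ, ∀ e : Fin 2 → TangentSpace (𝓡 n) x,
      Orthonormal ℝ e → curvature n x (e 0) (e 1) (e 0) (e 1) = κ) :
    HasConstantSectionalCurvature n M := by
  choose κ hκ using H
  rcases isEmpty_or_nonempty M with hM | ⟨⟨x₀⟩⟩
  · exact ⟨0, fun x => hM.elim x⟩
  · refine ⟨κ x₀, fun x e he => ?_⟩
    rw [hκ x e he]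
    exact (isLocallyConstant_sectional hn hκ).apply_eq_of_preconnectedSpace x x₀

end Charts

end Weitzenboeck
end

/-! ### The equivalence on the manifold. -/

theorem mainTheorem5 (n p : ℕ) (hp : 2 ≤ p) (hpn : p + 2 ≤ n)
    {M : Type*} [TopologicalSpace M] [ConnectedSpace M]
    [ChartedSpace (EuclideanSpace ℝ (Fin n)) M] [IsManifold (𝓡 n) ∞ M]
    [RiemannianBundle (fun x : M => TangentSpace (𝓡 n) x)]
    [IsContMDiffRiemannianBundle (𝓡 n) ∞ (EuclideanSpace ℝ (Fin n))
      (fun x : M => TangentSpace (𝓡 n) x)] :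
    Weitzenboeck.HasConstantWeitzenboeckCurvature n M p ↔
      (Weitzenboeck.HasConstantSectionalCurvature n M ∨
        (Weitzenboeck.IsConformallyFlat n M ∧ n = 2 * p)) := by
  have hV : ∀ x : M, Module.finrank ℝ (TangentSpace (𝓡 n) x) = n := fun x =>
    finrank_euclideanSpace_fin
  have hR := Weitzenboeck.isCurvatureLike_curvature (M := M) n
  constructor
  · intro H
    by_cases hnp : n = 2 * p
    · refine Or.inr ⟨fun x u v w z => ?_, hnp⟩
      obtain ⟨c, hc⟩ := H x
      exact Weitzenboeck.HasWeitzenboeckSectional.weyl_eq_zero (hR x) (hV x) hc hp hpn u v w z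
    · refine Or.inl (Weitzenboeck.hasConstantSectionalCurvature_of_pointwise (by lia) fun x => ?_)
      obtain ⟨c, hc⟩ := H x
      exact Weitzenboeck.HasWeitzenboeckSectional.sectional_const (hR x) (hV x) hc hp hpn hnp
  · rintro (⟨κ, hκ⟩ | ⟨hW, hnp⟩) x
    · exact Weitzenboeck.hasWeitzenboeckSectional_of_sectional_const (hR x)
        (by rw [hV x]; lia) (hκ x)
    · exact Weitzenboeck.hasWeitzenboeckSectional_of_weyl_eq_zero (hR x) ((hV x).trans hnp) (hW x)
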